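/- Let $G$ be a finite group generated by orthogonal hyperplane reflections of $n$-dimensional Euclidean space $\mathbb{R}^n$, and let $C_1,\dots,C_q$ be the conjugacy classes of reflections in $G$, with $N_a=|C_a|$. Let $G$ act on the polynomial functions on $V=\mathbb{C}^n$ by $(gp)(x)=p(g^{-1}x)$. Let $H_0$ be the space of harmonic polynomials of $G$, i.e. of the polynomials $\phi$ with $p(\partial)\phi=0$ for every $G$-invariant polynomial $p$ without constant term (where $p(\partial)$ is obtained from $p$ by replacing each orthonormal coordinate $x_i$ by $\partial/\partial x_i$), and let $H_0^k$ be the subspace of homogeneous harmonic polynomials of degree $k$. For an irreducible complex representation $V_j$ of $G$ put $$P_j(H_0,t)=\sum_{k\ge 0}\dim\mathrm{Hom}_G(V_j,H_0^k)\,t^k,$$ the generating polynomial of the multiplicities of $V_j$ in the $G$-modules $H_0^k$, and $$d^-_a(V_j)=\frac{2N_a\dim V_{j,\alpha}^-}{\dim V_j},\qquad a=1,\dots,q,$$ where $V_{j,\alpha}^-$ is the $(-1)$-eigenspace on $V_j$ of any reflection $s_\alpha\in C_a$. For each $a=1,\dots,q$ there is exactly one homomorphism $\chi_a:G\to\mathbb{C}^\times$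 with $\chi_a(s)=-1$ for all $s\in C_a$ and $\chi_a(s)=1$ for all reflections $s\in C_b$, $b\neq a$. Write $P_{j\otimes a}(H_0,t)$ for the generating polynomial defined as above for the irreducible representation $V_j\otimes\chi_a$. Then, for every irreducible $V_j$ and every $a=1,\dots,q$, $P_j(H_0,t)$ and $P_{j\otimes a}(H_0,t)$ are polynomials with positive values at $t=1$, and $$d^-_a(V_j)=N_a+\left.\frac{d}{dt}\right|_{t=1}\ln\frac{P_j(H_0,t)}{P_{j\otimes a}(H_0,t)}.$$ If $q=1$, then moreover, with $d^-(V_j)=d^-_1(V_j)$, $$d^-(V_j)=2\left.\frac{d}{dt}\right|_{t=1}\ln P_j(H_0,t).$$ -/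

import Mathlib

noncomputable section

namespace CoxeterHarmonic

open MvPolynomial

/-- Euclidean `n`-space. -/
abbrev Euc (n : ℕ) : Type := EuclideanSpace ℝ (Fin n)

/-- The orthogonal group of Euclidean `n`-space: linear isometries under composition. -/
abbrev OrthGroup (n : ℕ) : Type := Euc n ≃ₗᵢ[ℝ] Euc n

/-- Complex polynomial functions on the complexification of Euclidean `n`-space, in the standard
orthonormal coordinates. -/
abbrev Poly (n : ℕ) : Type := MvPolynomial (Fin n) ℂ

variable {n : ℕ}

/-- `g` is the orthogonal reflection in the hyperplane orthogonal to some nonzero vector. -/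
def IsReflection (g : OrthGroup n) : Prop :=
  ∃ v : Euc n, v ≠ 0 ∧ g = (ℝ ∙ v)ᗮ.reflection

/-- A finite group generated by orthogonal hyperplane reflections. -/
structure IsReflectionGroup (G : Subgroup (OrthGroup n)) : Prop where
  finite : Finite G
  closure_eq : Subgroup.closure {g : OrthGroup n | g ∈ G ∧ IsReflection g} = G

/-- The `(i, j)` matrix entry of an isometry in the standard basis. -/
def entry (g : OrthGroup n) (i j : Fin n) : ℝ := g (EuclideanSpace.single j 1) i

lemma apply_eq_sum_entry (g : OrthGroup n) (x : Euc n) (i : Fin n) :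
    g x i = ∑ j, entry g i j * x j := by
  have h : x = ∑ j, x j • EuclideanSpace.single j (1 : ℝ) := by
    ext i
    simp [Finset.sum_apply, Pi.single_apply]
  conv_lhs => rw [h]
  simp [entry, mul_comm]

lemma entry_one (i j : Fin n) : entry (1 : OrthGroup n) i j = if i = j then 1 else 0 := by
  simp [entry]

lemma entry_mul (g h : OrthGroup n) (i j : Fin n) :
    entry (g * h) i j = ∑ k, entry g i k * entry h k j :=
  apply_eq_sum_entry g (h (EuclideanSpace.single j 1)) i

/-- The action on polynomial functions, `(g p)(x) = p (g⁻¹ x)`: the coordinate function `x_i` goes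
to the linear function `x ↦ (g⁻¹ x)_i`. -/
def polyAct (g : OrthGroup n) : Poly n →ₐ[ℂ] Poly n :=
  aeval fun i => ∑ j, C (entry g⁻¹ i j : ℂ) * X j

lemma polyAct_one : polyAct (1 : OrthGroup n) = AlgHom.id ℂ (Poly n) := by
  refine MvPolynomial.algHom_ext fun i => ?_
  simp only [polyAct, inv_one, entry_one, aeval_X, AlgHom.coe_id, id]
  rw [Finset.sum_eq_single i] <;> simp +contextual [eq_comm]

lemma polyAct_mul (g h : OrthGroup n) : polyAct (g * h) = (polyAct g).comp (polyAct h) := by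
  ext i : 1
  simp only [polyAct, mul_inv_rev, entry_mul, aeval_X, AlgHom.comp_apply, map_sum, map_mul,
    aeval_C, Complex.ofReal_sum, Complex.ofReal_mul, Finset.sum_mul, Finset.mul_sum]
  rw [Finset.sum_comm]
  simp [MvPolynomial.algebraMap_eq, mul_assoc]

/-- The representation of `G` on polynomial functions, `(g p)(x) = p (g⁻¹ x)`. -/
def polyRep (G : Subgroup (OrthGroup n)) : Representation ℂ G (Poly n) where
  toFun g := (polyAct (g : OrthGroup n)).toLinearMap
  map_one' := by
    refine LinearMap.ext fun p => ?_
    simp [polyAct_one]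
  map_mul' g h := by
    refine LinearMap.ext fun p => ?_
    simp [polyAct_mul]

lemma commute_pderiv (i j : Fin n) :
    Commute (pderiv (R := ℂ) i).toLinearMap (pderiv (R := ℂ) j).toLinearMap := by
  have h : ⁅pderiv (R := ℂ) i, pderiv (R := ℂ) j⁆ = 0 := by
    apply MvPolynomial.derivation_ext
    intro k
    simp [Derivation.commutator_apply, pderiv_X, Pi.single_apply, apply_ite]
  refine LinearMap.ext fun p => ?_
  have := congrArg (fun D => D p) h
  simpa [Derivation.commutator_apply, sub_eq_zero] using this

lemma pairwise_commute_pderiv_pow (s : Fin n →₀ ℕ) :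
    ((Finset.univ : Finset (Fin n)) : Set (Fin n)).Pairwise
      (Function.onFun Commute fun i => (pderiv (R := ℂ) i).toLinearMap ^ s i) :=
  fun i _ j _ _ => (commute_pderiv i j).pow_pow _ _

/-- The iterated partial derivative `∏ i, ∂_i ^ (s i)`. -/
def diffMonomial (s : Fin n →₀ ℕ) : Module.End ℂ (Poly n) :=
  Finset.univ.noncommProd (fun i => (pderiv (R := ℂ) i).toLinearMap ^ s i)
    (pairwise_commute_pderiv_pow s)

/-- The constant coefficient differential operator `p(∂)`: every variable `x_i` of `p` is replaced
by the partial derivative `∂_i`. -/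
def diffOp (p : Poly n) : Module.End ℂ (Poly n) :=
  ∑ s ∈ p.support, coeff s p • diffMonomial s

/-- The `G`-invariant polynomials. -/
def IsInvariant (G : Subgroup (OrthGroup n)) (p : Poly n) : Prop :=
  ∀ g : G, polyRep G g p = p

/-- The space `H_0` of harmonic polynomials of `G`: the polynomials killed by `p(∂)` for
every `G`-invariant polynomial `p` without constant term. -/
def harmonic (G : Subgroup (OrthGroup n)) : Submodule ℂ (Poly n) :=
  ⨅ (p : Poly n) (_ : IsInvariant G p) (_ : constantCoeff p = 0), LinearMap.ker (diffOp p)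

/-- The space `H_0^k` of harmonic polynomials that are homogeneous of degree `k`. -/
def harmonicDeg (G : Subgroup (OrthGroup n)) (k : ℕ) : Submodule ℂ (Poly n) :=
  harmonic G ⊓ homogeneousSubmodule (Fin n) ℂ k

section Rep

variable {V : Type*} [AddCommGroup V] [Module ℂ V]

/-- The space `Hom_G(V, H_0^k)` of `G`-equivariant linear maps from `V` to `H_0^k`. -/
def homToHarmonic (G : Subgroup (OrthGroup n)) (ρ : Representation ℂ G V) (k : ℕ) :
    Submodule ℂ (ρ.IntertwiningMap (polyRep G)) where
  carrier := {f | ∀ v, f v ∈ harmonicDeg G k}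
  add_mem' hf hg v := add_mem (hf v) (hg v)
  zero_mem' _ := zero_mem _
  smul_mem' c _ hf v := Submodule.smul_mem _ c (hf v)

/-- The multiplicity of an irreducible representation in `H_0^k`, `dim Hom_G(V, H_0^k)`. -/
def multiplicity (G : Subgroup (OrthGroup n)) (ρ : Representation ℂ G V) (k : ℕ) : ℕ :=
  Module.finrank ℂ (homToHarmonic G ρ k)

/-- The Poincaré polynomial `P(H_0, t)` of a representation: the sum over `k` of its multiplicity
in `H_0^k` times `t ^ k`. -/
def poincare (G : Subgroup (OrthGroup n)) (ρ : Representation ℂ G V) : Polynomial ℝ :=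
  ∑ᶠ k : ℕ, Polynomial.monomial k (multiplicity G ρ k : ℝ)

/-- The number of elements of the conjugacy class of `s` in `G`. -/
def classCard {G : Subgroup (OrthGroup n)} (s : G) : ℕ :=
  Nat.card {r : G // IsConj s r}

/-- `d⁻(V) = 2 N dim (V⁻) / dim V`, with `N` the size of the conjugacy class of `s` and `V⁻` the
`(-1)`-eigenspace of `s` on `V`. -/
def dMinus {G : Subgroup (OrthGroup n)} (s : G) (ρ : Representation ℂ G V) : ℝ :=
  2 * classCard s * Module.finrank ℂ (Module.End.eigenspace (ρ s) (-1)) / Module.finrank ℂ V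

end Rep

/-- The one-dimensional representation of `G` on `ℂ` given by a character. -/
def charRep {G : Subgroup (OrthGroup n)} (χ : G →* ℂˣ) : Representation ℂ G ℂ where
  toFun g := (χ g : ℂ) • LinearMap.id
  map_one' := by
    ext
    simp
  map_mul' g h := by
    ext
    simp [mul_comm]

open Classical in
/-- `χ` is the one-dimensional character that is `-1` on the reflections conjugate to `s` and
`1` on all other reflections. -/
def IsClassCharacter {G : Subgroup (OrthGroup n)} (s : G) (χ : G →* ℂˣ) : Prop :=
  ∀ r : G, IsReflection (r : OrthGroup n) → χ r = if IsConj s r then -1 else 1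

end CoxeterHarmonic

end

noncomputable section

namespace CoxeterHarmonic

open MvPolynomial

variable {n : ℕ} {G : Subgroup (OrthGroup n)}

/-! ### The action on polynomials -/

/-! Write `S` for the polynomials, `I` for the ideal generated by the invariants without constant
term, `H` for the harmonic polynomials, and `H_g(t) = ∑ tr(g | H^k) t^k`. Everything is read off
from the behaviour of `H_g` at `t = 1` to first order.

Multiplication identifies `S` with (invariants) ⊗ `H`. Spanning holds because in each degree `H` is
the orthogonal complement of `I` for the apolar pairing (`exists_harmonicDeg_sub_mem`,
`mem_productSpan`). Linear disjointness is Chevalley's argument with divided differences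
(`mem_hilbertIdeal_of_relation`, `invariant_coeff_eq_zero`), and the only place where generation by
reflections enters this tensor decomposition. Comparing graded traces, `1 / det(1 - t g)` is the
Hilbert series of the invariants times `H_g(t)`. That series does not depend on `g`, so `H_g(t)
det(1 - t g) = H_1(t) (1 - t)^n` (`gradedCharacter_mul_eigenPoly`). The structure of the invariant
ring is never needed.

Hence `H_g` vanishes at 1 for `g ≠ 1`, to order at least two unless `g` is a reflection, and
`H_r'(1) = -H_1(1)/2` for a reflection `r`. Averaging against the character `χ_V` of a
representation `V` gives `P_V(1) = dim V · H_1(1) / |G|` and `P_V'(1) / P_V(1) = H_1'(1) / H_1(1) -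
(∑_r χ_V(r)) / (2 dim V)`, the sum being over all reflections (`logDeriv_poincare`).

Twisting `V` by the character of a class changes the sign of `χ_V` on that class alone. The
difference of the two logarithmic derivatives is therefore `-N χ_V(s) / dim V`, which is `d⁻ - N`
because `χ_V(s) = dim V - 2 dim V⁻`. For the trivial representation `P` is constant, which forces
`H_1'(1) / H_1(1)` to be half the number of reflections; this settles the case of a single class. -/

lemma polyAct_X (g : OrthGroup n) (i : Fin n) :
    polyAct g (X i) = ∑ j, C (entry g⁻¹ i j : ℂ) * X j := by
  simp [polyAct]

lemma polyRep_apply (G : Subgroup (OrthGroup n)) (g : G) (p : Poly n) :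
    polyRep G g p = polyAct (g : OrthGroup n) p := rfl

lemma polyAct_inv_polyAct (g : OrthGroup n) (p : Poly n) : polyAct g⁻¹ (polyAct g p) = p := by
  rw [← AlgHom.comp_apply, ← polyAct_mul, inv_mul_cancel, polyAct_one, AlgHom.id_apply]

lemma isHomogeneous_polyAct (g : OrthGroup n) {p : Poly n} {k : ℕ} (hp : p.IsHomogeneous k) :
    (polyAct g p).IsHomogeneous k := by
  have h : ∀ i, (∑ j, C (entry g⁻¹ i j : ℂ) * X j : Poly n).IsHomogeneous 1 := fun i =>
    IsHomogeneous.sum _ _ _ fun j _ => isHomogeneous_C_mul_X _ _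
  have := hp.aeval _ h
  rwa [one_mul] at this

lemma homogeneousComponent_polyAct (g : OrthGroup n) (p : Poly n) (k : ℕ) :
    homogeneousComponent k (polyAct g p) = polyAct g (homogeneousComponent k p) := by
  conv_lhs => rw [← sum_homogeneousComponent p]
  rw [map_sum, map_sum]
  have h : ∀ i, homogeneousComponent k (polyAct g (homogeneousComponent i p)) =
      if i = k then polyAct g (homogeneousComponent i p) else 0 := fun i => by
    rw [homogeneousComponent_of_mem
      (isHomogeneous_polyAct g (homogeneousComponent_isHomogeneous i p))]
    simp [eq_comm]
  simp only [h, Finset.sum_ite_eq', Finset.mem_range]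
  split_ifs with hk
  · rfl
  · rw [homogeneousComponent_eq_zero _ _ (by omega), map_zero]

lemma constantCoeff_polyAct (g : OrthGroup n) (p : Poly n) :
    constantCoeff (polyAct g p) = constantCoeff p := by
  have h : (constantCoeff : Poly n →+* ℂ).comp (polyAct g).toRingHom = constantCoeff := by
    refine MvPolynomial.ringHom_ext (fun r => ?_) fun i => ?_
    · simp
    · simp [polyAct]
  exact congrArg (fun f => f p) h

/-- Complex conjugation of the coefficients of a polynomial. -/
def conjPoly : Poly n →+* Poly n := MvPolynomial.map (starRingEnd ℂ)

lemma conjPoly_polyAct (g : OrthGroup n) (p : Poly n) :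
    conjPoly (polyAct g p) = polyAct g (conjPoly p) := by
  have h : (conjPoly : Poly n →+* Poly n).comp (polyAct g).toRingHom =
      (polyAct g).toRingHom.comp conjPoly := by
    refine MvPolynomial.ringHom_ext (fun r => ?_) fun i => ?_
    · simp [conjPoly, ← MvPolynomial.algebraMap_eq]
    · simp [polyAct, conjPoly]
  exact congrArg (fun f => f p) h

lemma coeff_conjPoly (p : Poly n) (s : Fin n →₀ ℕ) :
    coeff s (conjPoly p) = starRingEnd ℂ (coeff s p) := by
  simp [conjPoly, coeff_map]

lemma IsInvariant.homogeneousComponent {G : Subgroup (OrthGroup n)} {p : Poly n}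
    (hp : IsInvariant G p) (k : ℕ) : IsInvariant G (homogeneousComponent k p) := fun g => by
  rw [polyRep_apply, ← homogeneousComponent_polyAct, ← polyRep_apply, hp g]

lemma IsInvariant.conjPoly {G : Subgroup (OrthGroup n)} {p : Poly n}
    (hp : IsInvariant G p) : IsInvariant G (conjPoly p) := fun g => by
  rw [polyRep_apply, ← conjPoly_polyAct, ← polyRep_apply, hp g]

/-- The algebra of invariant polynomials. -/
def invariantAlgebra (G : Subgroup (OrthGroup n)) : Subalgebra ℂ (Poly n) where
  carrier := {p | IsInvariant G p}
  mul_mem' {a b} ha hb g := by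
    have ha := ha g
    have hb := hb g
    rw [polyRep_apply] at *
    rw [map_mul, ha, hb]
  add_mem' {a b} ha hb g := by rw [map_add, ha g, hb g]
  algebraMap_mem' r g := by rw [polyRep_apply, AlgHom.commutes]

/-- The ideal generated by the invariants without constant term. -/
def hilbertIdeal (G : Subgroup (OrthGroup n)) : Ideal (Poly n) :=
  Ideal.span {p | IsInvariant G p ∧ constantCoeff p = 0}

lemma mem_hilbertIdeal_of_isInvariant {G : Subgroup (OrthGroup n)} {p : Poly n}
    (hp : IsInvariant G p) (h0 : constantCoeff p = 0) : p ∈ hilbertIdeal G :=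
  Ideal.subset_span ⟨hp, h0⟩

lemma constantCoeff_of_mem_hilbertIdeal {G : Subgroup (OrthGroup n)} {p : Poly n}
    (hp : p ∈ hilbertIdeal G) : constantCoeff p = 0 := by
  have : hilbertIdeal G ≤ RingHom.ker (constantCoeff : Poly n →+* ℂ) :=
    Ideal.span_le.2 fun q hq => hq.2
  exact this hp

/-- Isometries have real matrices, so conjugation commutes with the action. This lets the bilinear
apolar pairing serve as a Hermitian form compatible with the ideal. -/
lemma conjPoly_mem_hilbertIdeal {G : Subgroup (OrthGroup n)} {p : Poly n}
    (hp : p ∈ hilbertIdeal G) : conjPoly p ∈ hilbertIdeal G := by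
  have : hilbertIdeal G ≤ (hilbertIdeal G).comap conjPoly := Ideal.span_le.2 fun q hq =>
    mem_hilbertIdeal_of_isInvariant hq.1.conjPoly (by
      have := hq.2
      rw [constantCoeff_eq] at this ⊢
      rw [coeff_conjPoly, this, map_zero])
  exact this hp

lemma homogeneousComponent_mul_of_isHomogeneous {p q : Poly n} {a : ℕ} (hp : p.IsHomogeneous a)
    (k : ℕ) : homogeneousComponent k (p * q) =
      if a ≤ k then p * homogeneousComponent (k - a) q else 0 := by
  conv_lhs => rw [← sum_homogeneousComponent q]
  rw [Finset.mul_sum, map_sum]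
  have h : ∀ i, homogeneousComponent k (p * homogeneousComponent i q) =
      if a + i = k then p * homogeneousComponent i q else 0 := fun i => by
    rw [homogeneousComponent_of_mem (hp.mul (homogeneousComponent_isHomogeneous i q))]
    simp [eq_comm]
  simp only [h]
  split_ifs with hk
  · have h2 : ∀ i, (a + i = k) ↔ i = k - a := fun i => by omega
    simp only [h2, Finset.sum_ite_eq', Finset.mem_range]
    split_ifs with h3
    · rfl
    · rw [homogeneousComponent_eq_zero _ _ (by omega), mul_zero]
  · exact Finset.sum_eq_zero fun i _ => if_neg (by omega)

/-! ### Differential operators -/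

lemma diffOp_eq_sum (p : Poly n) {T : Finset (Fin n →₀ ℕ)} (h : p.support ⊆ T) :
    diffOp p = ∑ s ∈ T, coeff s p • diffMonomial s :=
  Finset.sum_subset h fun s _ hs => by rw [notMem_support_iff.1 hs, zero_smul]

lemma diffOp_add (p q : Poly n) : diffOp (p + q) = diffOp p + diffOp q := by
  classical
  rw [diffOp_eq_sum p (T := p.support ∪ q.support) Finset.subset_union_left,
    diffOp_eq_sum q (T := p.support ∪ q.support) Finset.subset_union_right,
    diffOp_eq_sum (p + q) support_add, ← Finset.sum_add_distrib]
  exact Finset.sum_congr rfl fun s _ => by rw [coeff_add, add_smul]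

lemma diffOp_monomial (s : Fin n →₀ ℕ) (c : ℂ) : diffOp (monomial s c) = c • diffMonomial s := by
  classical
  rw [diffOp_eq_sum _ (T := {s}) support_monomial_subset]
  simp

lemma diffMonomial_add (s t : Fin n →₀ ℕ) :
    diffMonomial (s + t) = diffMonomial s * diffMonomial t := by
  unfold diffMonomial
  rw [← Finset.noncommProd_mul_distrib _ _ (pairwise_commute_pderiv_pow s)
    (pairwise_commute_pderiv_pow t) fun i _ j _ _ => (commute_pderiv i j).pow_pow _ _]
  refine Finset.noncommProd_congr rfl (fun i _ => ?_) _
  simp [pow_add]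

lemma diffMonomial_zero : diffMonomial (0 : Fin n →₀ ℕ) = 1 := by
  unfold diffMonomial
  refine (Finset.noncommProd_eq_pow_card _ _ _ 1 fun i _ => ?_).trans (one_pow _)
  simp

lemma diffMonomial_single (i : Fin n) :
    diffMonomial (Finsupp.single i 1) = (pderiv (R := ℂ) i).toLinearMap := by
  classical
  unfold diffMonomial
  refine (Finset.mul_noncommProd_erase _ (Finset.mem_univ i) _ _).symm.trans
    ((congrArg _ (Finset.noncommProd_eq_pow_card _ _ _ 1 fun j hj => ?_)).trans ?_)
  · rw [Finsupp.single_eq_of_ne (Finset.ne_of_mem_erase hj), pow_zero]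
  · simp

/-- Partial derivatives commute. Consequently a polynomial killed by the generators of an ideal is
killed by the whole ideal. -/
lemma diffOp_mul (p q : Poly n) : diffOp (p * q) = diffOp p * diffOp q := by
  induction p using MvPolynomial.induction_on' with
  | monomial s a =>
    induction q using MvPolynomial.induction_on' with
    | monomial t b =>
      rw [monomial_mul, diffOp_monomial, diffOp_monomial, diffOp_monomial, diffMonomial_add,
        smul_mul_smul_comm]
    | add q₁ q₂ h₁ h₂ => rw [mul_add, diffOp_add, h₁, h₂, diffOp_add, mul_add]
  | add p₁ p₂ h₁ h₂ => rw [add_mul, diffOp_add, h₁, h₂, diffOp_add, add_mul]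

lemma diffOp_C (c : ℂ) : diffOp (C c : Poly n) = c • 1 := by
  rw [← monomial_zero', diffOp_monomial, diffMonomial_zero]

lemma diffOp_X (i : Fin n) : diffOp (X i : Poly n) = (pderiv (R := ℂ) i).toLinearMap := by
  rw [X, diffOp_monomial, diffMonomial_single, one_smul]

lemma diffOp_sum {ι : Type*} (T : Finset ι) (f : ι → Poly n) :
    diffOp (∑ i ∈ T, f i) = ∑ i ∈ T, diffOp (f i) := by
  classical
  induction T using Finset.induction_on with
  | empty => simp [diffOp]
  | insert i T hi ih => rw [Finset.sum_insert hi, Finset.sum_insert hi, diffOp_add, ih]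

lemma entry_inv (g : OrthGroup n) (i j : Fin n) : entry g⁻¹ i j = entry g j i := by
  have h : ∀ (g : OrthGroup n) (i j : Fin n), entry g i j =
      inner ℝ (EuclideanSpace.single i 1) (g (EuclideanSpace.single j 1)) := fun g i j => by
    rw [EuclideanSpace.inner_single_left]; simp [entry]
  rw [h, h, real_inner_comm, ← LinearIsometryEquiv.inner_map_map g]
  simp

lemma sum_entry_mul_entry (g : OrthGroup n) (i k : Fin n) :
    ∑ j, entry g i j * entry g k j = if i = k then 1 else 0 := by
  rw [← entry_one, ← mul_inv_cancel g, entry_mul]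
  simp [entry_inv]

/-- For an orthogonal matrix the coordinates and the partial derivatives transform in the same way.
This makes `(p, q) ↦ p(∂) q` equivariant, and the harmonic polynomials stable under the group. -/
lemma polyAct_pderiv (g : OrthGroup n) (i : Fin n) (q : Poly n) :
    polyAct g (pderiv i q) = ∑ j, C (entry g⁻¹ i j : ℂ) * pderiv j (polyAct g q) := by
  classical
  induction q using MvPolynomial.induction_on with
  | C a =>
    have : polyAct g (C a) = C a := (polyAct g).commutes a
    simp [this]
  | add p q hp hq => simp only [map_add, hp, hq, mul_add, Finset.sum_add_distrib]
  | mul_X p k hp =>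
    have h : ∀ j, pderiv j (polyAct g (X k : Poly n)) = C (entry g⁻¹ k j : ℂ) := fun j => by
      simp [polyAct_X, pderiv_X, Pi.single_apply]
    have h2 : polyAct g (pderiv i (X k : Poly n)) = C (if i = k then 1 else 0) := by
      rw [pderiv_X, Pi.single_apply]
      rcases eq_or_ne i k with rfl | hik
      · rw [if_pos rfl, if_pos rfl, map_one, C_1]
      · rw [if_neg hik.symm, if_neg hik, map_zero, C_0]
    simp only [Derivation.leibniz, map_mul, map_add, smul_eq_mul, hp, h, h2, mul_add,
      Finset.sum_add_distrib]
    congr 1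
    · have := congrArg (fun x : ℝ => (x : ℂ)) (sum_entry_mul_entry g⁻¹ i k)
      simp only [Complex.ofReal_sum, Complex.ofReal_mul] at this
      have h3 : ((if i = k then 1 else 0 : ℝ) : ℂ) = if i = k then 1 else 0 := by
        split_ifs <;> simp
      rw [← h3, ← this, map_sum, Finset.mul_sum]
      refine Finset.sum_congr rfl fun j _ => ?_
      rw [C_mul]; ring
    · rw [Finset.mul_sum]
      exact Finset.sum_congr rfl fun j _ => by ring

lemma polyAct_diffOp (g : OrthGroup n) (p q : Poly n) :
    polyAct g (diffOp p q) = diffOp (polyAct g p) (polyAct g q) := by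
  induction p using MvPolynomial.induction_on generalizing q with
  | C a =>
    have : polyAct g (C a) = C a := (polyAct g).commutes a
    simp [this, diffOp_C]
  | add p₁ p₂ h₁ h₂ => simp only [map_add, diffOp_add, LinearMap.add_apply, h₁, h₂]
  | mul_X p i hp =>
    rw [diffOp_mul, Module.End.mul_apply, hp, map_mul, diffOp_mul, Module.End.mul_apply, polyAct_X,
      diffOp_sum]
    congr 1
    rw [diffOp_X]
    refine (polyAct_pderiv g i q).trans ?_
    rw [LinearMap.sum_apply]
    refine Finset.sum_congr rfl fun j _ => ?_
    rw [diffOp_mul, diffOp_C, diffOp_X, Module.End.mul_apply, C_mul']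
    rfl

/-! ### The apolar pairing -/

/-- The derivative `∂^s` shifts monomials by `s` and multiplies them by positive reals. -/
lemma exists_coeff_diffMonomial (s : Fin n →₀ ℕ) : ∃ c : (Fin n →₀ ℕ) → ℝ, (∀ m, 0 < c m) ∧
    ∀ m q, coeff m (diffMonomial s q) = c m * coeff (m + s) q := by
  classical
  induction s using Finsupp.induction_linear with
  | zero => exact ⟨1, by simp, by simp [diffMonomial_zero]⟩
  | add s t hs ht =>
    obtain ⟨c, hc, h⟩ := hs
    obtain ⟨d, hd, h'⟩ := ht
    refine ⟨fun m => c m * d (m + s), fun m => mul_pos (hc _) (hd _), fun m q => ?_⟩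
    rw [diffMonomial_add, Module.End.mul_apply, h, h', add_assoc]
    push_cast; ring
  | single i k =>
    induction k with
    | zero => exact ⟨1, by simp, by simp [diffMonomial_zero]⟩
    | succ k ih =>
      obtain ⟨c, hc, h⟩ := ih
      refine ⟨fun m => c m * ((m + Finsupp.single i k) i + 1), fun m => ?_, fun m q => ?_⟩
      · have := hc m
        positivity
      · rw [Finsupp.single_add, diffMonomial_add, diffMonomial_single, Module.End.mul_apply, h]
        refine (congrArg _ (coeff_pderiv q _)).trans ?_
        rw [add_assoc]
        push_cast; ring

/-- The apolar pairing `(p(∂) q)(0)`. -/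
def pairing (p q : Poly n) : ℂ := constantCoeff (diffOp p q)

/-- Monomials are orthogonal for the pairing. The weights are in fact factorials, but only their
positivity matters: symmetry, nondegeneracy and definiteness all come from this diagonal form. -/
lemma exists_pairing_eq_sum : ∃ c : (Fin n →₀ ℕ) → ℝ, (∀ s, 0 < c s) ∧ ∀ p q : Poly n,
    pairing p q = ∑ s ∈ p.support, c s * coeff s p * coeff s q := by
  choose c hc h using exists_coeff_diffMonomial (n := n)
  refine ⟨fun s => c s 0, fun s => hc s 0, fun p q => ?_⟩
  rw [pairing, diffOp, LinearMap.sum_apply, map_sum]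
  refine Finset.sum_congr rfl fun s _ => ?_
  rw [constantCoeff_eq, LinearMap.smul_apply, coeff_smul, h, zero_add, smul_eq_mul]
  ring

lemma pairing_comm (p q : Poly n) : pairing p q = pairing q p := by
  classical
  obtain ⟨c, -, h⟩ := exists_pairing_eq_sum (n := n)
  have key : ∀ p q : Poly n, pairing p q =
      ∑ s ∈ p.support ∪ q.support, c s * coeff s p * coeff s q := fun p q => by
    rw [h]
    refine Finset.sum_subset Finset.subset_union_left fun s _ hs => ?_
    rw [notMem_support_iff.1 hs]; simp
  rw [key p q, key q p, Finset.union_comm]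
  exact Finset.sum_congr rfl fun s _ => by ring

lemma pairing_monomial_ne_zero {q : Poly n} (hq : q ≠ 0) :
    ∃ s : Fin n →₀ ℕ, pairing (monomial s 1) q ≠ 0 := by
  classical
  obtain ⟨c, hc, h⟩ := exists_pairing_eq_sum (n := n)
  obtain ⟨s, hs⟩ := ne_zero_iff.1 hq
  refine ⟨s, ?_⟩
  rw [h, support_monomial, if_neg one_ne_zero, Finset.sum_singleton]
  have := (hc s).ne'
  simp [this, hs]

lemma eq_zero_of_pairing_conjPoly {p : Poly n} (h0 : pairing (conjPoly p) p = 0) : p = 0 := by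
  classical
  obtain ⟨c, hc, h⟩ := exists_pairing_eq_sum (n := n)
  rw [pairing_comm, h] at h0
  have h1 : ∀ s, (c s : ℂ) * coeff s p * coeff s (conjPoly p) =
      ((c s * Complex.normSq (coeff s p) : ℝ) : ℂ) := fun s => by
    rw [coeff_conjPoly, mul_assoc, Complex.mul_conj]; push_cast; rfl
  simp only [h1] at h0
  rw [← Complex.ofReal_sum, Complex.ofReal_eq_zero, Finset.sum_eq_zero_iff_of_nonneg] at h0
  · rw [← support_eq_empty, Finset.eq_empty_iff_forall_notMem]
    intro s hs
    have := h0 s hs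
    rw [mul_eq_zero, Complex.normSq_eq_zero] at this
    exact mem_support_iff.1 hs (this.resolve_left (hc s).ne')
  · exact fun s _ => mul_nonneg (hc s).le (Complex.normSq_nonneg _)

lemma pairing_add_left (p q r : Poly n) : pairing (p + q) r = pairing p r + pairing q r := by
  simp [pairing, diffOp_add]

lemma pairing_add_right (p q r : Poly n) : pairing p (q + r) = pairing p q + pairing p r := by
  simp [pairing]

lemma pairing_smul_right (a : ℂ) (p q : Poly n) : pairing p (a • q) = a * pairing p q := by
  simp [pairing]

lemma pairing_smul_left (a : ℂ) (p q : Poly n) : pairing (a • p) q = a * pairing p q := by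
  rw [pairing_comm, pairing_smul_right, pairing_comm]

lemma pairing_eq_homogeneousComponent {k : ℕ} {q : Poly n} (hq : q.IsHomogeneous k) (p : Poly n) :
    pairing p q = pairing (homogeneousComponent k p) q := by
  classical
  obtain ⟨c, -, h⟩ := exists_pairing_eq_sum (n := n)
  rw [pairing_comm, pairing_comm _ q, h, h]
  refine Finset.sum_congr rfl fun s hs => ?_
  rw [coeff_homogeneousComponent, if_pos]
  by_contra hne
  exact mem_support_iff.1 hs (hq.coeff_eq_zero hne)

/-! ### Harmonic polynomials -/

lemma mem_harmonic {φ : Poly n} : φ ∈ harmonic G ↔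
    ∀ p, IsInvariant G p → constantCoeff p = 0 → diffOp p φ = 0 := by
  simp [harmonic, Submodule.mem_iInf]

/-- In the converse direction the ideal absorbs monomials: the pairing of `m * p` with `φ` is the
pairing of `m` with `p(∂) φ`, and a polynomial orthogonal to all monomials is zero. -/
lemma mem_harmonic_iff_pairing {φ : Poly n} : φ ∈ harmonic G ↔
    ∀ x ∈ hilbertIdeal G, pairing x φ = 0 := by
  rw [mem_harmonic]
  constructor
  · intro h x hx
    suffices diffOp x φ = 0 by rw [pairing, this, map_zero]
    induction hx using Submodule.span_induction with
    | mem x hx => exact h x hx.1 hx.2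
    | zero => simp [diffOp]
    | add x y _ _ hx hy => rw [diffOp_add, LinearMap.add_apply, hx, hy, add_zero]
    | smul a x _ hx => rw [smul_eq_mul, diffOp_mul, Module.End.mul_apply, hx, map_zero]
  · intro h p hp h0
    by_contra hne
    obtain ⟨s, hs⟩ := pairing_monomial_ne_zero hne
    apply hs
    have := h (monomial s 1 * p) (Ideal.mul_mem_left _ _ (mem_hilbertIdeal_of_isInvariant hp h0))
    rwa [pairing, diffOp_mul] at this

lemma polyAct_mem_harmonic (g : G) {φ : Poly n} (h : φ ∈ harmonic G) :
    polyAct (g : OrthGroup n) φ ∈ harmonic G := by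
  rw [mem_harmonic] at *
  intro p hp h0
  rw [← polyRep_apply, ← hp g, polyRep_apply, polyRep_apply, ← polyAct_diffOp, h p hp h0, map_zero]

lemma polyAct_mem_harmonicDeg (g : G) {k : ℕ} {φ : Poly n} (h : φ ∈ harmonicDeg G k) :
    polyAct (g : OrthGroup n) φ ∈ harmonicDeg G k :=
  ⟨polyAct_mem_harmonic g h.1, isHomogeneous_polyAct _ h.2⟩

lemma disjoint_hilbertIdeal_harmonic {φ : Poly n} (h : φ ∈ harmonic G)
    (h' : φ ∈ hilbertIdeal G) : φ = 0 :=
  eq_zero_of_pairing_conjPoly (mem_harmonic_iff_pairing.1 h _ (conjPoly_mem_hilbertIdeal h'))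

instance (k : ℕ) : FiniteDimensional ℂ (homogeneousSubmodule (Fin n) ℂ k) :=
  Module.Finite.iff_fg.2 (homogeneousSubmodule_fg _ _ k)

/-- The apolar pairing on homogeneous polynomials of degree `k`. -/
def pairingForm (n k : ℕ) : LinearMap.BilinForm ℂ (homogeneousSubmodule (Fin n) ℂ k) :=
  LinearMap.mk₂ ℂ (fun p q => pairing (p : Poly n) (q : Poly n))
    (fun _ _ _ => pairing_add_left _ _ _) (fun _ _ _ => pairing_smul_left _ _ _)
    (fun _ _ _ => pairing_add_right _ _ _) (fun _ _ _ => pairing_smul_right _ _ _)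

lemma homogeneousComponent_mem_hilbertIdeal {p : Poly n} (hp : p ∈ hilbertIdeal G) (k : ℕ) :
    homogeneousComponent k p ∈ hilbertIdeal G := by
  induction hp using Submodule.span_induction generalizing k with
  | mem x hx =>
    refine mem_hilbertIdeal_of_isInvariant (hx.1.homogeneousComponent k) ?_
    rw [constantCoeff_eq, coeff_homogeneousComponent]
    split_ifs
    · exact hx.2
    · rfl
  | zero => rw [map_zero]; exact zero_mem _
  | add x y _ _ hx hy => rw [map_add]; exact add_mem (hx k) (hy k)
  | smul a x _ hx =>
    rw [smul_eq_mul, ← sum_homogeneousComponent a, Finset.sum_mul, map_sum]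
    refine sum_mem fun i _ => ?_
    rw [homogeneousComponent_mul_of_isHomogeneous (homogeneousComponent_isHomogeneous i a)]
    split_ifs
    · exact Ideal.mul_mem_left _ _ (hx _)
    · exact zero_mem _

/-- Every homogeneous polynomial is harmonic modulo the ideal generated by the invariants
without constant term. -/
lemma exists_harmonicDeg_sub_mem {p : Poly n} {k : ℕ} (hp : p.IsHomogeneous k) :
    ∃ h ∈ harmonicDeg G k, p - h ∈ hilbertIdeal G := by
  set W : Submodule ℂ (homogeneousSubmodule (Fin n) ℂ k) :=
    ((hilbertIdeal G).restrictScalars ℂ).comap (Submodule.subtype _) with hW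
  have hrefl : (pairingForm n k).IsRefl := fun x y h => by
    change pairing (y : Poly n) x = 0
    rw [pairing_comm]
    exact h
  have hmem : ∀ x ∈ (pairingForm n k).orthogonal W, (x : Poly n) ∈ harmonic G := by
    intro x hx
    rw [mem_harmonic_iff_pairing]
    intro y hy
    rw [pairing_eq_homogeneousComponent x.2]
    exact hx ⟨homogeneousComponent k y, homogeneousComponent_isHomogeneous k y⟩
      (homogeneousComponent_mem_hilbertIdeal hy k)
  -- For a reflexive form on a finite-dimensional space, a subspace that meets its orthogonal in
  -- zero is complementary to it. Working in a single degree provides the finite dimension.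
  have hcompl : IsCompl W ((pairingForm n k).orthogonal W) := by
    rw [LinearMap.BilinForm.isCompl_orthogonal_iff_disjoint hrefl, Submodule.disjoint_def]
    intro x hx hx'
    exact Subtype.ext (disjoint_hilbertIdeal_harmonic (hmem x hx') hx)
  have htop : (⟨p, hp⟩ : homogeneousSubmodule (Fin n) ℂ k) ∈
      W ⊔ (pairingForm n k).orthogonal W := by
    rw [hcompl.sup_eq_top]; trivial
  obtain ⟨y, hy, z, hz, hyz⟩ := Submodule.mem_sup.1 htop
  refine ⟨z, ⟨hmem z hz, z.2⟩, ?_⟩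
  have : p = y + z := congrArg Subtype.val hyz.symm
  rw [this, add_sub_cancel_right]
  exact hy

/-! ### The Reynolds operator -/

lemma polyAct_mem_hilbertIdeal (g : G) {p : Poly n} (hp : p ∈ hilbertIdeal G) :
    polyAct (g : OrthGroup n) p ∈ hilbertIdeal G := by
  have : hilbertIdeal G ≤ (hilbertIdeal G).comap (polyAct (g : OrthGroup n)) :=
    Ideal.span_le.2 fun q hq => by
      change polyAct (g : OrthGroup n) q ∈ hilbertIdeal G
      rw [← polyRep_apply, hq.1 g]
      exact mem_hilbertIdeal_of_isInvariant hq.1 hq.2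
  exact this hp

section Reynolds

variable (G) in
/-- The average of a polynomial over the group. -/
def reynolds (p : Poly n) : Poly n :=
  C (Nat.card G : ℂ)⁻¹ * ∑ᶠ g : G, polyAct (g : OrthGroup n) p

lemma reynolds_eq_sum [Fintype G] (p : Poly n) :
    reynolds G p = C (Nat.card G : ℂ)⁻¹ * ∑ g : G, polyAct (g : OrthGroup n) p := by
  rw [reynolds, finsum_eq_sum_of_fintype]

lemma reynolds_zero : reynolds G (0 : Poly n) = 0 := by
  simp [reynolds]

variable [Finite G]

lemma isInvariant_reynolds (p : Poly n) : IsInvariant G (reynolds G p) := by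
  cases nonempty_fintype G
  intro g
  have : polyAct (g : OrthGroup n) (C (Nat.card G : ℂ)⁻¹) = C (Nat.card G : ℂ)⁻¹ :=
    (polyAct _).commutes _
  rw [polyRep_apply, reynolds_eq_sum, map_mul, this, map_sum]
  have h : ∀ x : G, polyAct (g : OrthGroup n) (polyAct (x : OrthGroup n) p) =
      polyAct ((g * x : G) : OrthGroup n) p := fun x => by
    rw [Subgroup.coe_mul, polyAct_mul, AlgHom.comp_apply]
  rw [Finset.sum_congr rfl fun x _ => h x]
  exact congrArg _ ((Group.mulLeft_bijective g).sum_comp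
    fun x : G => polyAct (x : OrthGroup n) p)

lemma reynolds_mul {f : Poly n} (hf : IsInvariant G f) (p : Poly n) :
    reynolds G (f * p) = f * reynolds G p := by
  cases nonempty_fintype G
  have h : ∑ g : G, polyAct (g : OrthGroup n) (f * p) =
      f * ∑ g : G, polyAct (g : OrthGroup n) p := by
    rw [Finset.mul_sum]
    refine Finset.sum_congr rfl fun g _ => ?_
    rw [map_mul, ← polyRep_apply, hf g]
  rw [reynolds_eq_sum, reynolds_eq_sum, h, mul_left_comm]

lemma reynolds_sum {ι : Type*} (T : Finset ι) (p : ι → Poly n) :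
    reynolds G (∑ i ∈ T, p i) = ∑ i ∈ T, reynolds G (p i) := by
  cases nonempty_fintype G
  simp only [reynolds_eq_sum, map_sum]
  exact (congrArg _ Finset.sum_comm).trans (Finset.mul_sum _ _ _)

lemma reynolds_add (p q : Poly n) : reynolds G (p + q) = reynolds G p + reynolds G q := by
  cases nonempty_fintype G
  simp only [reynolds_eq_sum, map_add, Finset.sum_add_distrib, mul_add]

lemma sub_reynolds_mem {J : Ideal (Poly n)} {p : Poly n}
    (h : ∀ g : G, p - polyAct (g : OrthGroup n) p ∈ J) : p - reynolds G p ∈ J := by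
  cases nonempty_fintype G
  have hc : (Nat.card G : ℂ) ≠ 0 := Nat.cast_ne_zero.2 Nat.card_pos.ne'
  have : p - reynolds G p =
      C (Nat.card G : ℂ)⁻¹ * ∑ g : G, (p - polyAct (g : OrthGroup n) p) := by
    rw [reynolds_eq_sum, Finset.sum_sub_distrib, mul_sub, Finset.sum_const, Finset.card_univ,
      ← Nat.card_eq_fintype_card, nsmul_eq_mul, ← mul_assoc, ← map_natCast C, ← C_mul,
      inv_mul_cancel₀ hc, C_1, one_mul]
  rw [this]
  exact J.mul_mem_left _ (sum_mem fun g _ => h g)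

end Reynolds

/-! ### Divided differences -/

/-- The linear form with coefficient vector `v`. -/
def linearForm (v : Euc n) : Poly n := ∑ i, C (v i : ℂ) * X i

lemma coeff_linearForm (v : Euc n) (i : Fin n) :
    coeff (Finsupp.single i 1) (linearForm v) = v i := by
  classical
  simp [linearForm, coeff_sum, coeff_C_mul, coeff_X, Finsupp.single_left_inj]

lemma isHomogeneous_linearForm (v : Euc n) : (linearForm v).IsHomogeneous 1 :=
  IsHomogeneous.sum _ _ _ fun _ _ => isHomogeneous_C_mul_X _ _

lemma linearForm_ne_zero {v : Euc n} (hv : v ≠ 0) : linearForm v ≠ 0 := by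
  intro h
  apply hv
  ext i
  have := coeff_linearForm v i
  rw [h, coeff_zero] at this
  exact (Complex.ofReal_eq_zero.1 this.symm)

lemma reflection_apply_eq (v x : Euc n) :
    (ℝ ∙ v)ᗮ.reflection x = x - (2 * (inner ℝ v x / ‖v‖ ^ 2)) • v := by
  rw [Submodule.reflection_orthogonal_apply, Submodule.reflection_singleton_apply]
  simp [mul_smul, two_smul]

/-- Modulo the linear form of `v` the reflection fixes every coordinate function, hence, being an
algebra homomorphism, every polynomial. -/
lemma linearForm_dvd_sub_reflection (v : Euc n) (p : Poly n) :
    linearForm v ∣ p - polyAct (ℝ ∙ v)ᗮ.reflection p := by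
  have key : (Ideal.Quotient.mkₐ ℂ (Ideal.span {linearForm v})).comp
      (polyAct (ℝ ∙ v)ᗮ.reflection) = Ideal.Quotient.mkₐ ℂ (Ideal.span {linearForm v}) := by
    refine MvPolynomial.algHom_ext fun i => ?_
    rw [AlgHom.comp_apply]
    refine Ideal.Quotient.eq.2 (Ideal.mem_span_singleton.2 ?_)
    refine ⟨C ((-(2 * (v i / ‖v‖ ^ 2)) : ℝ) : ℂ), ?_⟩
    have hX : (X i : Poly n) = ∑ j, C ((if i = j then 1 else 0 : ℝ) : ℂ) * X j := by
      rw [Finset.sum_eq_single i] <;> simp +contextual [eq_comm]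
    rw [polyAct_X, hX, ← Finset.sum_sub_distrib, linearForm, Finset.sum_mul]
    refine Finset.sum_congr rfl fun j _ => ?_
    have : entry (ℝ ∙ v)ᗮ.reflection⁻¹ i j =
        (if i = j then 1 else 0) - (2 * (v j / ‖v‖ ^ 2)) * v i := by
      rw [Submodule.reflection_inv, entry, reflection_apply_eq, EuclideanSpace.inner_single_right]
      simp
    rw [this]
    simp only [div_eq_mul_inv, Complex.ofReal_sub, Complex.ofReal_mul, Complex.ofReal_neg, C_sub,
      C_mul, C_neg]
    ring
  rw [← Ideal.mem_span_singleton, ← Ideal.Quotient.eq]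
  exact (congrArg (fun f => f p) key).symm

lemma totalDegree_polyAct_le (g : OrthGroup n) (p : Poly n) :
    (polyAct g p).totalDegree ≤ p.totalDegree := by
  conv_lhs => rw [← sum_homogeneousComponent p, map_sum]
  refine totalDegree_finsetSum_le fun i hi => ?_
  refine (isHomogeneous_polyAct g (homogeneousComponent_isHomogeneous i p)).totalDegree_le.trans ?_
  exact Nat.lt_succ_iff.1 (Finset.mem_range.1 hi)

/-- **Chevalley's lemma.** -/
lemma mem_hilbertIdeal_of_relation (hG : IsReflectionGroup G) {ι : Type*} {T : Finset ι} {i₀ : ι}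
    {f : ι → Poly n} (hf₀ : IsInvariant G (f i₀)) (hf : ∀ i ∈ T, IsInvariant G (f i))
    (hnot : ∀ u : Poly n, IsInvariant G u → constantCoeff u = 1 → ∀ r : ι → Poly n,
      (∀ i, IsInvariant G (r i)) → u * f i₀ ≠ ∑ i ∈ T, r i * f i)
    (p : ι → Poly n) (hp : f i₀ * p i₀ + ∑ i ∈ T, f i * p i = 0) : p i₀ ∈ hilbertIdeal G := by
  have := hG.finite
  induction hd : (p i₀).totalDegree using Nat.strong_induction_on generalizing p with
  | _ d ih =>
  subst hd
  -- Subtract from the relation its image under the reflection and cancel the linear form: the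
  -- quotients `q i` satisfy a relation with the same `f i`, and `q i₀` has smaller degree than `p
  -- i₀`.
  have hrefl : ∀ g ∈ G, IsReflection g → p i₀ - polyAct g (p i₀) ∈ hilbertIdeal G := by
    rintro g hg ⟨v, hv, rfl⟩
    choose q hq using fun i => linearForm_dvd_sub_reflection v (p i)
    rw [hq]
    refine Ideal.mul_mem_left _ _ ?_
    by_cases hq0 : q i₀ = 0
    · rw [hq0]; exact zero_mem _
    refine ih _ ?_ q ?_ rfl
    · have h1 : (linearForm v * q i₀).totalDegree ≤ (p i₀).totalDegree := by
        rw [← hq]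
        exact (totalDegree_sub _ _).trans (max_le le_rfl (totalDegree_polyAct_le _ _))
      rw [totalDegree_mul_of_isDomain (linearForm_ne_zero hv) hq0,
        (isHomogeneous_linearForm v).totalDegree (linearForm_ne_zero hv)] at h1
      omega
    · apply mul_left_cancel₀ (linearForm_ne_zero hv)
      have h0 : polyAct (ℝ ∙ v)ᗮ.reflection (f i₀ * p i₀ + ∑ i ∈ T, f i * p i) = 0 := by
        rw [hp, map_zero]
      have hinv : ∀ f : Poly n, IsInvariant G f → polyAct (ℝ ∙ v)ᗮ.reflection f = f :=
        fun f hf => hf ⟨_, hg⟩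
      have h1 : polyAct (ℝ ∙ v)ᗮ.reflection (∑ i ∈ T, f i * p i) =
          ∑ i ∈ T, f i * polyAct (ℝ ∙ v)ᗮ.reflection (p i) := by
        rw [map_sum]
        exact Finset.sum_congr rfl fun i hi => by rw [map_mul, hinv _ (hf i hi)]
      rw [map_add, map_mul, hinv _ hf₀, h1] at h0
      have h2 : ∀ i, linearForm v * (f i * q i) =
          f i * p i - f i * polyAct (ℝ ∙ v)ᗮ.reflection (p i) := fun i => by
        rw [← mul_sub, hq]; ring
      rw [mul_add, Finset.mul_sum, h2, Finset.sum_congr rfl fun i _ => h2 i,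
        Finset.sum_sub_distrib, mul_zero]
      linear_combination hp - h0
  have hall : ∀ g : G, p i₀ - polyAct (g : OrthGroup n) (p i₀) ∈ hilbertIdeal G := by
    rintro ⟨g, hg⟩
    have hg' := hg
    rw [← hG.closure_eq] at hg'
    induction hg' using Subgroup.closure_induction with
    | mem x hx => exact hrefl x hx.1 hx.2
    | one => rw [polyAct_one, AlgHom.id_apply, sub_self]; exact zero_mem _
    | mul x y hx hy hx' hy' =>
      rw [hG.closure_eq] at hx hy
      have := add_mem (hx' hx) (polyAct_mem_hilbertIdeal ⟨x, hx⟩ (hy' hy))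
      rw [map_sub, sub_add_sub_cancel] at this
      rwa [polyAct_mul, AlgHom.comp_apply]
    | inv x hx hx' =>
      rw [hG.closure_eq] at hx
      have := polyAct_mem_hilbertIdeal ⟨x⁻¹, inv_mem hx⟩ (hx' hx)
      rw [map_sub, polyAct_inv_polyAct] at this
      rw [← neg_sub]
      exact neg_mem this
  have h1 := sub_reynolds_mem hall
  have hrel : f i₀ * reynolds G (p i₀) + ∑ i ∈ T, f i * reynolds G (p i) = 0 := by
    rw [← reynolds_zero (G := G), ← hp, reynolds_add, reynolds_mul hf₀, reynolds_sum]
    exact congrArg _ (Finset.sum_congr rfl fun i hi => (reynolds_mul (hf i hi) _).symm)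
  -- A nonzero constant term `c` would make `c⁻¹ * reynolds G (p i₀)` a multiplier `u` excluded by
  -- `hnot`. Allowing any `u` with constant term 1 in `hnot`, rather than `u = 1`, is what makes
  -- homogeneity assumptions unnecessary.
  have hc : constantCoeff (reynolds G (p i₀)) = 0 := by
    by_contra hc
    set c := constantCoeff (reynolds G (p i₀))
    have hC : ∀ (a : ℂ) (q : Poly n), IsInvariant G q → IsInvariant G (C a * q) :=
      fun a q hq => (invariantAlgebra G).mul_mem ((invariantAlgebra G).algebraMap_mem a) hq
    refine hnot (C c⁻¹ * reynolds G (p i₀)) (hC _ _ (isInvariant_reynolds _)) ?_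
      (fun i => C (-c⁻¹) * reynolds G (p i)) (fun i => hC _ _ (isInvariant_reynolds _)) ?_
    · rw [map_mul, constantCoeff_C]
      exact inv_mul_cancel₀ hc
    · have : ∑ i ∈ T, C (-c⁻¹) * reynolds G (p i) * f i =
          - (C c⁻¹ * ∑ i ∈ T, f i * reynolds G (p i)) := by
        rw [Finset.mul_sum, ← Finset.sum_neg_distrib]
        refine Finset.sum_congr rfl fun i _ => ?_
        rw [C_neg]; ring
      rw [this]
      linear_combination C c⁻¹ * hrel
  have h2 := mem_hilbertIdeal_of_isInvariant (isInvariant_reynolds (p i₀)) hc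
  simpa using add_mem h1 h2

lemma sub_C_mem_hilbertIdeal {u : Poly n} (hu : IsInvariant G u) :
    u - C (constantCoeff u) ∈ hilbertIdeal G :=
  mem_hilbertIdeal_of_isInvariant
    ((invariantAlgebra G).sub_mem hu ((invariantAlgebra G).algebraMap_mem _)) (by simp)

/-- Polynomials that are linearly independent modulo the ideal generated by the invariants without
constant term are linearly independent over the invariants. -/
lemma invariant_coeff_eq_zero (hG : IsReflectionGroup G) {ι : Type*} (T : Finset ι)
    (f h : ι → Poly n) (hf : ∀ i ∈ T, IsInvariant G (f i))
    (hlin : ∀ c : ι → ℂ, ∑ i ∈ T, C (c i) * h i ∈ hilbertIdeal G → ∀ i ∈ T, c i = 0)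
    (hrel : ∑ i ∈ T, f i * h i = 0) : ∀ i ∈ T, f i = 0 := by
  classical
  induction T using Finset.induction_on generalizing h with
  | empty => simp
  | insert i₀ T hi₀ ih =>
    have hfT : ∀ i ∈ T, IsInvariant G (f i) := fun i hi => hf i (Finset.mem_insert_of_mem hi)
    have hf₀ : IsInvariant G (f i₀) := hf i₀ (Finset.mem_insert_self _ _)
    rw [Finset.sum_insert hi₀] at hrel
    have hmem : h i₀ ∉ hilbertIdeal G := fun hm => by
      have := hlin (fun i => if i = i₀ then 1 else 0) ?_ i₀ (Finset.mem_insert_self _ _)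
      · simp at this
      · rw [Finset.sum_insert hi₀, Finset.sum_eq_zero fun i hi => ?_]
        · simpa using hm
        · rw [if_neg (ne_of_mem_of_not_mem hi hi₀), C_0, zero_mul]
    have hex : ∃ u : Poly n, IsInvariant G u ∧ constantCoeff u = 1 ∧ ∃ r : ι → Poly n,
        (∀ i, IsInvariant G (r i)) ∧ u * f i₀ = ∑ i ∈ T, r i * f i := by
      by_contra hcon
      exact hmem (mem_hilbertIdeal_of_relation hG hf₀ hfT
        (fun u hu hu1 r hr he => hcon ⟨u, hu, hu1, r, hr, he⟩) h hrel)
    obtain ⟨u, hu, hu1, r, hr, he⟩ := hex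
    have hT : ∀ i ∈ T, f i = 0 := by
      -- Multiplying the relation by `u` and eliminating `f i₀` leaves a relation over `T` with
      -- these new polynomials. Modulo the ideal they are `h i` plus `constantCoeff (r i)` times `h
      -- i₀`, so they are still independent there; this explains the coefficient given to `h i₀`
      -- below.
      refine ih (fun i => u * h i + r i * h i₀) hfT (fun c hc => ?_) ?_
      · have key := hlin (fun i => if i = i₀ then ∑ i ∈ T, c i * constantCoeff (r i) else c i) ?_
        · intro i hi
          have := key i (Finset.mem_insert_of_mem hi)
          rwa [if_neg (ne_of_mem_of_not_mem hi hi₀)] at this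
        · rw [Finset.sum_insert hi₀, if_pos rfl]
          have h1 : ∑ i ∈ T, C (if i = i₀ then ∑ i ∈ T, c i * constantCoeff (r i) else c i) * h i =
              ∑ i ∈ T, C (c i) * h i := Finset.sum_congr rfl fun i hi => by
            rw [if_neg (ne_of_mem_of_not_mem hi hi₀)]
          rw [h1, map_sum, Finset.sum_mul, ← Finset.sum_add_distrib]
          have h2 : ∑ i ∈ T, (C (c i) * (u * h i + r i * h i₀) -
              (C (c i * constantCoeff (r i)) * h i₀ + C (c i) * h i)) ∈ hilbertIdeal G := by
            refine sum_mem fun i _ => ?_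
            have h3 := sub_C_mem_hilbertIdeal hu
            have h4 := sub_C_mem_hilbertIdeal (hr i)
            rw [hu1, C_1] at h3
            have := add_mem (Ideal.mul_mem_left _ (C (c i) * h i) h3)
              (Ideal.mul_mem_left _ (C (c i) * h i₀) h4)
            convert this using 1
            rw [C_mul]; ring
          rw [Finset.sum_sub_distrib] at h2
          have := sub_mem hc h2
          rwa [sub_sub_cancel] at this
      · have : ∑ i ∈ T, f i * (u * h i + r i * h i₀) =
            u * ∑ i ∈ T, f i * h i + h i₀ * ∑ i ∈ T, r i * f i := by
          rw [Finset.mul_sum, Finset.mul_sum, ← Finset.sum_add_distrib]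
          exact Finset.sum_congr rfl fun i _ => by ring
        rw [this, ← he]
        linear_combination u * hrel
    intro i hi
    rcases Finset.mem_insert.1 hi with rfl | hi
    · rw [Finset.sum_eq_zero fun i hi => by rw [hT i hi, mul_zero]] at he
      have hu0 : u ≠ 0 := fun h => by simp [h] at hu1
      exact (mul_eq_zero.1 he).resolve_left hu0
    · exact hT i hi

/-- Invariants and harmonic polynomials are linearly disjoint over `ℂ`. -/
lemma harmonic_coeff_eq_zero (hG : IsReflectionGroup G) {κ : Type*} [Fintype κ]
    (f p : κ → Poly n) (hf : ∀ k, IsInvariant G (f k)) (hlin : LinearIndependent ℂ f)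
    (hp : ∀ k, p k ∈ harmonic G) (hrel : ∑ k, f k * p k = 0) : ∀ k, p k = 0 := by
  set W : Submodule ℂ (Poly n) := Submodule.span ℂ (Set.range p)
  have hWH : W ≤ harmonic G := Submodule.span_le.2 (by rintro _ ⟨k, rfl⟩; exact hp k)
  have : FiniteDimensional ℂ W := FiniteDimensional.span_of_finite ℂ (Set.finite_range p)
  set e := Module.finBasis ℂ W
  set q : κ → W := fun k => ⟨p k, Submodule.subset_span ⟨k, rfl⟩⟩
  have hq : ∀ k, p k = ∑ b, C (e.repr (q k) b) * (e b : Poly n) := fun k => by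
    have := congrArg Subtype.val (e.sum_repr (q k))
    simp only [Submodule.coe_sum, Submodule.coe_smul, ← C_mul'] at this
    exact this.symm
  -- In a basis of the span of the `p k` the relation acquires invariant coefficients. A basis of
  -- harmonic polynomials is independent modulo the ideal, so these coefficients vanish, and the
  -- independence of the `f k` then kills each scalar.
  have hz := invariant_coeff_eq_zero hG Finset.univ (fun b => ∑ k, C (e.repr (q k) b) * f k)
    (fun b => (e b : Poly n))
    (fun b _ => (invariantAlgebra G).sum_mem fun k _ =>
      (invariantAlgebra G).mul_mem ((invariantAlgebra G).algebraMap_mem _) (hf k))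
    (fun c hc b _ => by
      have h0 : ∑ b, C (c b) * (e b : Poly n) = ((∑ b, c b • e b : W) : Poly n) := by
        simp [C_mul']
      rw [h0] at hc
      have := disjoint_hilbertIdeal_harmonic (hWH (∑ b, c b • e b : W).2) hc
      exact Fintype.linearIndependent_iff.1 e.linearIndependent c (Subtype.ext this) b)
    (by
      rw [← hrel]
      simp only [Finset.sum_mul]
      rw [Finset.sum_comm]
      refine Finset.sum_congr rfl fun k _ => ?_
      conv_rhs => rw [hq k, Finset.mul_sum]
      exact Finset.sum_congr rfl fun b _ => by ring)
  intro k
  rw [hq k]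
  refine Finset.sum_eq_zero fun b _ => ?_
  have := hz b (Finset.mem_univ b)
  simp only [C_mul'] at this
  rw [Fintype.linearIndependent_iff.1 hlin _ this k, C_0, zero_mul]

/-! ### Harmonic polynomials have bounded degree -/

/-- The coordinate is a root of the monic polynomial whose roots are its translates under the group.
The lower coefficients are invariants without constant term, the translates being linear forms. -/
lemma X_pow_mem_hilbertIdeal [Finite G] (i : Fin n) :
    (X i : Poly n) ^ Nat.card G ∈ hilbertIdeal G := by
  cases nonempty_fintype G
  set F : Polynomial (Poly n) :=
    ∏ g : G, (Polynomial.X - Polynomial.C (polyAct (g : OrthGroup n) (X i))) with hF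
  have hmap : ∀ f : Poly n →+* Poly n, F.map f =
      ∏ g : G, (Polynomial.X - Polynomial.C (f (polyAct (g : OrthGroup n) (X i)))) := fun f => by
    rw [hF, Polynomial.map_prod]
    simp
  have hinv : ∀ j, IsInvariant G (F.coeff j) := by
    intro j g
    have h1 : F.map (polyAct (g : OrthGroup n)).toRingHom = F := by
      rw [hmap, hF]
      have h : ∀ x : G, (polyAct (g : OrthGroup n)).toRingHom (polyAct (x : OrthGroup n) (X i)) =
          polyAct ((g * x : G) : OrthGroup n) (X i) := fun x => by
        rw [Subgroup.coe_mul, polyAct_mul, AlgHom.comp_apply]; rfl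
      rw [Finset.prod_congr rfl fun x _ => by rw [h x]]
      exact (Group.mulLeft_bijective g).prod_comp fun x : G =>
        (Polynomial.X - Polynomial.C (polyAct (x : OrthGroup n) (X i)))
    rw [polyRep_apply]
    conv_rhs => rw [← h1, Polynomial.coeff_map]
    rfl
  have hmonic : F.Monic := Polynomial.monic_prod_of_monic _ _ fun _ _ => Polynomial.monic_X_sub_C _
  have hdeg : F.natDegree = Nat.card G := by
    rw [hF, Polynomial.natDegree_prod_of_monic _ _ fun _ _ => Polynomial.monic_X_sub_C _]
    simp
  have hcc : F.map (constantCoeff : Poly n →+* ℂ) = Polynomial.X ^ Nat.card G := by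
    rw [hF, Polynomial.map_prod]
    simp [constantCoeff_polyAct]
  have hroot : F.eval (X i) = 0 := by
    rw [hF, Polynomial.eval_prod]
    refine Finset.prod_eq_zero (Finset.mem_univ (1 : G)) ?_
    simp [polyAct_one]
  rw [Polynomial.eval_eq_sum_range, Finset.sum_range_succ, hmonic.coeff_natDegree, one_mul,
    hdeg] at hroot
  rw [eq_neg_of_add_eq_zero_right hroot]
  refine neg_mem (sum_mem fun j hj => Ideal.mul_mem_right _ _
    (mem_hilbertIdeal_of_isInvariant (hinv j) ?_))
  rw [← Polynomial.coeff_map, hcc, Polynomial.coeff_X_pow,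
    if_neg (Finset.mem_range.1 hj).ne]

/-- By the pigeonhole principle every monomial of such a degree is divisible by the `Nat.card G`-th
power of some variable. -/
lemma mem_hilbertIdeal_of_isHomogeneous [Finite G] {p : Poly n} {k : ℕ} (hp : p.IsHomogeneous k)
    (hk : n * Nat.card G < k) : p ∈ hilbertIdeal G := by
  classical
  rw [p.as_sum]
  refine sum_mem fun s hs => ?_
  have hs' : ∑ i, s i = k := by
    have := hp (mem_support_iff.1 hs)
    rw [← this, Finsupp.weight_apply, Finsupp.sum_fintype] <;> simp
  obtain ⟨i, hi⟩ : ∃ i, Nat.card G ≤ s i := by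
    by_contra! hcon
    have : ∑ i, s i ≤ ∑ _i : Fin n, Nat.card G := Finset.sum_le_sum fun i _ => (hcon i).le
    simp at this
    omega
  rw [monomial_eq, Finsupp.prod_fintype _ _ (by simp)]
  refine Ideal.mul_mem_left _ _ ?_
  rw [← Finset.mul_prod_erase _ _ (Finset.mem_univ i), ← Nat.add_sub_of_le hi, pow_add, mul_assoc]
  exact Ideal.mul_mem_right _ _ (X_pow_mem_hilbertIdeal i)

lemma harmonicDeg_eq_bot [Finite G] {k : ℕ} (hk : n * Nat.card G < k) : harmonicDeg G k = ⊥ := by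
  rw [eq_bot_iff]
  intro φ hφ
  exact disjoint_hilbertIdeal_harmonic hφ.1 (mem_hilbertIdeal_of_isHomogeneous hφ.2 hk)

/-! ### Polynomials as combinations of products of invariants and harmonic polynomials -/

/-- The homogeneous invariants of degree `k`. -/
def invariantDeg (G : Subgroup (OrthGroup n)) (k : ℕ) : Submodule ℂ (Poly n) :=
  Subalgebra.toSubmodule (invariantAlgebra G) ⊓ homogeneousSubmodule (Fin n) ℂ k

lemma IsInvariant.homogeneousComponent_mem {p : Poly n} (hp : IsInvariant G p) (k : ℕ) :
    MvPolynomial.homogeneousComponent k p ∈ invariantDeg G k :=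
  ⟨hp.homogeneousComponent k, homogeneousComponent_isHomogeneous k p⟩

instance (k : ℕ) : FiniteDimensional ℂ (harmonicDeg G k) :=
  Submodule.finiteDimensional_of_le inf_le_right

instance (k : ℕ) : FiniteDimensional ℂ (invariantDeg G k) :=
  Submodule.finiteDimensional_of_le inf_le_right

/-- The span of the products of homogeneous invariants and harmonic polynomials of total
degree `k`. -/
def productSpan (G : Subgroup (OrthGroup n)) (k : ℕ) : Submodule ℂ (Poly n) :=
  Submodule.span ℂ {p | ∃ a b f h, a + b = k ∧ f ∈ invariantDeg G a ∧ h ∈ harmonicDeg G b ∧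
    p = f * h}

lemma mul_mem_productSpan {a b : ℕ} {f q : Poly n} (hf : f ∈ invariantDeg G a)
    (hq : q ∈ productSpan G b) : f * q ∈ productSpan G (a + b) := by
  induction hq using Submodule.span_induction with
  | mem x hx =>
    obtain ⟨c, d, e, h, hcd, he, hh, rfl⟩ := hx
    refine Submodule.subset_span ⟨a + c, d, f * e, h, by omega,
      ⟨(invariantAlgebra G).mul_mem hf.1 he.1, hf.2.mul he.2⟩, hh, by ring⟩
  | zero => rw [mul_zero]; exact zero_mem _
  | add x y _ _ hx hy => rw [mul_add]; exact add_mem hx hy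
  | smul c x _ hx => rw [mul_smul_comm]; exact Submodule.smul_mem _ _ hx

lemma mem_productSpan {p : Poly n} {k : ℕ} (hp : p.IsHomogeneous k) : p ∈ productSpan G k := by
  induction k using Nat.strong_induction_on generalizing p with
  | _ k ih =>
  -- The cofactor `a` is universally quantified so that the span induction survives multiplication
  -- by polynomials. An invariant component of positive degree leaves a cofactor of degree less than
  -- `k`, to which `ih` applies.
  have hI : ∀ y ∈ hilbertIdeal G, ∀ a : Poly n,
      homogeneousComponent k (a * y) ∈ productSpan G k := by
    intro y hy
    induction hy using Submodule.span_induction with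
    | mem x hx =>
      intro a
      rw [mul_comm, ← sum_homogeneousComponent x, Finset.sum_mul, map_sum]
      refine sum_mem fun i _ => ?_
      rw [homogeneousComponent_mul_of_isHomogeneous (homogeneousComponent_isHomogeneous i x)]
      split_ifs with hik
      · rcases Nat.eq_zero_or_pos i with rfl | hi
        · have := hx.2
          rw [constantCoeff_eq] at this
          rw [homogeneousComponent_zero, this, C_0, zero_mul]
          exact zero_mem _
        · have := mul_mem_productSpan (hx.1.homogeneousComponent_mem i)
            (ih (k - i) (by omega) (homogeneousComponent_isHomogeneous (k - i) a))
          rwa [Nat.add_sub_of_le hik] at this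
      · exact zero_mem _
    | zero => intro a; rw [mul_zero, map_zero]; exact zero_mem _
    | add x y _ _ hx hy => intro a; rw [mul_add, map_add]; exact add_mem (hx a) (hy a)
    | smul c x _ hx => intro a; rw [smul_eq_mul, ← mul_assoc]; exact hx _
  obtain ⟨h, hh, hmem⟩ := exists_harmonicDeg_sub_mem (G := G) hp
  have h1 := hI _ hmem 1
  rw [one_mul, homogeneousComponent_of_mem (hp.sub hh.2), if_pos rfl] at h1
  have h2 : h ∈ productSpan G k := Submodule.subset_span
    ⟨0, k, 1, h, by simp, ⟨(invariantAlgebra G).one_mem, isHomogeneous_one _ _⟩, hh, by simp⟩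
  simpa using add_mem h1 h2

/-! ### Graded traces -/

/-- The action of an isometry on homogeneous polynomials of degree `k`. -/
def degAct (g : OrthGroup n) (k : ℕ) : Module.End ℂ (homogeneousSubmodule (Fin n) ℂ k) :=
  (polyAct g).toLinearMap.restrict fun _ hp => isHomogeneous_polyAct g hp

/-- The representation on harmonic polynomials of degree `k`. -/
def harmonicRep (G : Subgroup (OrthGroup n)) (k : ℕ) : Representation ℂ G (harmonicDeg G k) where
  toFun g := (polyRep G g).restrict fun _ hp => polyAct_mem_harmonicDeg g hp
  map_one' := by
    refine LinearMap.ext fun p => Subtype.ext ?_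
    simp
  map_mul' g h := by
    refine LinearMap.ext fun p => Subtype.ext ?_
    exact congrArg (fun f => f (p : Poly n)) ((polyRep G).map_mul g h)

lemma coe_degAct_apply (g : OrthGroup n) {k : ℕ} (p : homogeneousSubmodule (Fin n) ℂ k) :
    (degAct g k p : Poly n) = polyAct g (p : Poly n) := rfl

/-- Multiplication of harmonic polynomials by a homogeneous invariant. -/
def mulHarmonic {a b k : ℕ} (hk : a + b = k) (f : invariantDeg G a) :
    harmonicDeg G b →ₗ[ℂ] homogeneousSubmodule (Fin n) ℂ k where
  toFun h := ⟨f * h, hk ▸ f.2.2.mul h.2.2⟩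
  map_add' _ _ := Subtype.ext (mul_add _ _ _)
  map_smul' _ _ := Subtype.ext (mul_smul_comm _ _ _)

/-- The indices of a homogeneous basis of invariants of degree at most `k`. -/
abbrev InvariantIndex (G : Subgroup (OrthGroup n)) (k : ℕ) : Type :=
  Σ x : Finset.HasAntidiagonal.antidiagonal k, Fin (Module.finrank ℂ (invariantDeg G x.1.1))

/-- A homogeneous basis of the invariants of degree at most `k`. -/
def invariantBasis {k : ℕ} (j : InvariantIndex G k) : invariantDeg G j.1.1.1 :=
  Module.finBasis ℂ (invariantDeg G j.1.1.1) j.2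

lemma linearIndependent_invariantBasis (k : ℕ) :
    LinearIndependent ℂ fun j : InvariantIndex G k => (invariantBasis j : Poly n) := by
  rw [Fintype.linearIndependent_iff]
  intro c hc
  rintro ⟨x, i⟩
  rw [Fintype.sum_sigma] at hc
  have h1 := congrArg (homogeneousComponent x.1.1) hc
  rw [map_sum, map_zero, Finset.sum_eq_single x] at h1
  · have hmem : (∑ i, c ⟨x, i⟩ • (invariantBasis (⟨x, i⟩ : InvariantIndex G k) : Poly n)) ∈
        homogeneousSubmodule (Fin n) ℂ x.1.1 :=
      sum_mem fun i _ => Submodule.smul_mem _ _ (invariantBasis ⟨x, i⟩).2.2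
    rw [homogeneousComponent_of_mem hmem, if_pos rfl] at h1
    refine Fintype.linearIndependent_iff.1
      (Module.finBasis ℂ (invariantDeg G x.1.1)).linearIndependent (fun i => c ⟨x, i⟩) ?_ i
    refine Subtype.ext ?_
    simpa [invariantBasis] using h1
  · intro y _ hy
    have hmem : (∑ i, c ⟨y, i⟩ • (invariantBasis (⟨y, i⟩ : InvariantIndex G k) : Poly n)) ∈
        homogeneousSubmodule (Fin n) ℂ y.1.1 :=
      sum_mem fun i _ => Submodule.smul_mem _ _ (invariantBasis ⟨y, i⟩).2.2
    rw [homogeneousComponent_of_mem hmem, if_neg]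
    intro he
    apply hy
    have h1 := Finset.HasAntidiagonal.mem_antidiagonal.1 x.2
    have h2 := Finset.HasAntidiagonal.mem_antidiagonal.1 y.2
    exact Subtype.ext (Prod.ext he.symm (by omega))
  · simp

/-- The summand of the homogeneous polynomials of degree `k` belonging to a basis invariant. -/
def harmonicSummand {k : ℕ} (j : InvariantIndex G k) :
    Submodule ℂ (homogeneousSubmodule (Fin n) ℂ k) :=
  LinearMap.range (mulHarmonic (Finset.HasAntidiagonal.mem_antidiagonal.1 j.1.2) (invariantBasis j))

-- This is the degree `k` part of the isomorphism between the polynomials and (invariants) ⊗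
-- (harmonics). Independence is `harmonic_coeff_eq_zero`, exhaustion is `mem_productSpan`.
open Classical in
lemma isInternal_harmonicSummand (hG : IsReflectionGroup G) (k : ℕ) :
    DirectSum.IsInternal (harmonicSummand (G := G) (k := k)) := by
  refine DirectSum.isInternal_submodule_of_iSupIndep_of_iSup_eq_top ?_ ?_
  · rw [iSupIndep_iff_finsetSum_eq_zero_imp_eq_zero]
    intro T v hv hsum
    have hv' : ∀ j, ∃ h : harmonicDeg G j.1.1.2, (if j ∈ T then v j else 0) =
        mulHarmonic (Finset.HasAntidiagonal.mem_antidiagonal.1 j.1.2) (invariantBasis j) h := fun j => by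
      split_ifs with hj
      · obtain ⟨h, hh⟩ := hv j hj
        exact ⟨h, hh.symm⟩
      · exact ⟨0, (map_zero _).symm⟩
    choose h hh using hv'
    have h0 := harmonic_coeff_eq_zero hG (fun j : InvariantIndex G k => (invariantBasis j : Poly n))
      (fun j => (h j : Poly n)) (fun j => (invariantBasis j).2.1)
      (linearIndependent_invariantBasis k) (fun j => (h j).2.1) (by
        have h1 : ∑ j, (if j ∈ T then v j else 0) = 0 := by
          rw [Finset.sum_ite_mem, Finset.univ_inter, hsum]
        have h2 := congrArg Subtype.val h1
        rw [Submodule.coe_sum] at h2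
        rw [← Submodule.coe_zero (p := homogeneousSubmodule (Fin n) ℂ k), ← h2]
        exact Finset.sum_congr rfl fun j _ => by rw [hh j]; rfl)
    intro j hj
    have h3 := hh j
    rw [if_pos hj, show h j = 0 from Subtype.ext (h0 j), map_zero] at h3
    exact h3
  · rw [eq_top_iff]
    rintro ⟨p, hp⟩ -
    have hle : productSpan G k ≤ (⨆ j : InvariantIndex G k, harmonicSummand j).map
        (Submodule.subtype _) := by
      refine Submodule.span_le.2 ?_
      rintro _ ⟨a, b, f, h, hab, hf, hh, rfl⟩
      set x : Finset.HasAntidiagonal.antidiagonal k := ⟨(a, b), Finset.HasAntidiagonal.mem_antidiagonal.2 hab⟩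
      have hsum := congrArg Subtype.val
        ((Module.finBasis ℂ (invariantDeg G a)).sum_repr ⟨f, hf⟩)
      rw [Submodule.coe_sum] at hsum
      change _ = f at hsum
      rw [← hsum, Finset.sum_mul]
      refine sum_mem fun i _ => ?_
      rw [Submodule.coe_smul, smul_mul_assoc]
      refine Submodule.smul_mem _ _ ?_
      refine ⟨mulHarmonic hab (Module.finBasis ℂ (invariantDeg G a) i) ⟨h, hh⟩, ?_, rfl⟩
      exact Submodule.mem_iSup_of_mem (⟨x, i⟩ : InvariantIndex G k) ⟨⟨h, hh⟩, rfl⟩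
    obtain ⟨q, hq, hqp⟩ := hle (mem_productSpan (G := G) hp)
    rwa [show (⟨p, hp⟩ : homogeneousSubmodule (Fin n) ℂ k) = q from Subtype.ext hqp.symm]

open Classical in
lemma trace_eq_sum_trace_of_isInternal_range {ι K E : Type*} {F : ι → Type*} [Fintype ι] [Field K]
    [AddCommGroup E] [Module K E] [FiniteDimensional K E] [∀ i, AddCommGroup (F i)]
    [∀ i, Module K (F i)] (m : ∀ i, F i →ₗ[K] E) (hinj : ∀ i, Function.Injective (m i))
    (hint : DirectSum.IsInternal fun i => LinearMap.range (m i)) (S : Module.End K E)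
    (T : ∀ i, Module.End K (F i)) (hcomm : ∀ i x, S (m i x) = m i (T i x)) :
    LinearMap.trace K E S = ∑ i, LinearMap.trace K (F i) (T i) := by
  have hmaps : ∀ i, Set.MapsTo S (LinearMap.range (m i)) (LinearMap.range (m i)) := by
    rintro i _ ⟨h, rfl⟩
    exact ⟨T i h, (hcomm i h).symm⟩
  rw [LinearMap.trace_eq_sum_trace_restrict hint hmaps]
  refine Finset.sum_congr rfl fun i _ => ?_
  rw [← LinearMap.trace_conj' _ (LinearEquiv.ofInjective _ (hinj i))]
  refine congrArg _ (LinearMap.ext fun y => ?_)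
  obtain ⟨h, rfl⟩ := (LinearEquiv.ofInjective _ (hinj i)).surjective y
  rw [LinearEquiv.conj_apply_apply, LinearEquiv.symm_apply_apply]
  exact Subtype.ext (hcomm i h)

/-- The trace on homogeneous polynomials as a convolution of the dimensions of the spaces of
invariants with the traces on harmonic polynomials. -/
theorem trace_degAct (hG : IsReflectionGroup G) (g : G) (k : ℕ) :
    LinearMap.trace ℂ _ (degAct (g : OrthGroup n) k) =
      ∑ x ∈ Finset.HasAntidiagonal.antidiagonal k,
        (Module.finrank ℂ (invariantDeg G x.1) : ℂ) * (harmonicRep G x.2).character g := by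
  classical
  rw [trace_eq_sum_trace_of_isInternal_range
    (fun j : InvariantIndex G k => mulHarmonic
      (Finset.HasAntidiagonal.mem_antidiagonal.1 j.1.2) (invariantBasis j))
    (fun j h h' he => Subtype.ext (mul_left_cancel₀
      ((linearIndependent_invariantBasis (G := G) k).ne_zero j) (congrArg Subtype.val he)))
    (by convert isInternal_harmonicSummand hG k using 1 <;> rfl) (degAct (g : OrthGroup n) k)
    (fun j => harmonicRep G _ g) (fun j h => Subtype.ext ?_)]
  · rw [Fintype.sum_sigma, ← Finset.sum_coe_sort (Finset.HasAntidiagonal.antidiagonal k)]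
    refine Finset.sum_congr rfl fun x _ => ?_
    change ∑ _y : Fin (Module.finrank ℂ (invariantDeg G x.1.1)),
      (harmonicRep G x.1.2).character g = _
    rw [Finset.sum_const, Finset.card_univ, Fintype.card_fin, nsmul_eq_mul]
  · rw [coe_degAct_apply]
    change polyAct (g : OrthGroup n) (_ * _) = _ * _
    rw [map_mul, ← polyRep_apply, (invariantBasis j).2.1 g]
    rfl

/-! ### Linear substitutions and eigenbases -/

/-- The substitution `X_i ↦ ∑ j, M i j X_j`. -/
def linSubst (M : Matrix (Fin n) (Fin n) ℂ) : Poly n →ₐ[ℂ] Poly n :=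
  aeval fun i => ∑ j, C (M i j) * X j

lemma linSubst_X (M : Matrix (Fin n) (Fin n) ℂ) (i : Fin n) :
    linSubst M (X i) = ∑ j, C (M i j) * X j := by
  simp [linSubst]

lemma linSubst_one : linSubst (1 : Matrix (Fin n) (Fin n) ℂ) = AlgHom.id ℂ (Poly n) := by
  refine MvPolynomial.algHom_ext fun i => ?_
  rw [linSubst_X, AlgHom.id_apply, Finset.sum_eq_single i]
  · simp
  · intro j _ hj
    rw [Matrix.one_apply_ne hj.symm, C_0, zero_mul]
  · simp

lemma linSubst_comp (M N : Matrix (Fin n) (Fin n) ℂ) :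
    (linSubst M).comp (linSubst N) = linSubst (N * M) := by
  refine MvPolynomial.algHom_ext fun i => ?_
  have hC : ∀ a : ℂ, linSubst M (C a) = C a := fun a => (linSubst M).commutes a
  simp only [AlgHom.comp_apply, linSubst_X, map_sum, map_mul, hC, Matrix.mul_apply, Finset.sum_mul,
    Finset.mul_sum]
  rw [Finset.sum_comm]
  exact Finset.sum_congr rfl fun _ _ => Finset.sum_congr rfl fun _ _ => by ring

lemma isHomogeneous_linSubst (M : Matrix (Fin n) (Fin n) ℂ) {p : Poly n} {k : ℕ}
    (hp : p.IsHomogeneous k) : (linSubst M p).IsHomogeneous k := by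
  have h : ∀ i, (∑ j, C (M i j) * X j : Poly n).IsHomogeneous 1 := fun i =>
    IsHomogeneous.sum _ _ _ fun j _ => isHomogeneous_C_mul_X _ _
  have := hp.aeval _ h
  rwa [one_mul] at this

lemma trace_eq_sum_of_basis {ι K E : Type*} [Fintype ι] [Field K] [AddCommGroup E] [Module K E]
    (b : Module.Basis ι K E) (f : Module.End K E) (μ : ι → K) (h : ∀ i, f (b i) = μ i • b i) :
    LinearMap.trace K E f = ∑ i, μ i := by
  classical
  rw [LinearMap.trace_eq_matrix_trace K b, Matrix.trace]
  refine Finset.sum_congr rfl fun i _ => ?_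
  rw [Matrix.diag_apply, LinearMap.toMatrix_apply, h]
  simp

/-- An operator of finite order is annihilated by the separable polynomial `X ^ m - 1`, so it is
semisimple and its eigenvectors span. -/
lemma exists_eigenbasis {E : Type*} [AddCommGroup E] [Module ℂ E] [FiniteDimensional ℂ E]
    {m : ℕ} (hm : m ≠ 0) (f : Module.End ℂ E) (hf : f ^ m = 1) :
    ∃ (b : Module.Basis (Fin (Module.finrank ℂ E)) ℂ E) (μ : Fin (Module.finrank ℂ E) → ℂ),
      ∀ i, f (b i) = μ i • b i := by
  have hsq : Squarefree (Polynomial.X ^ m - Polynomial.C (1 : ℂ)) :=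
    (Polynomial.separable_X_pow_sub_C (1 : ℂ) (Nat.cast_ne_zero.2 hm) one_ne_zero).squarefree
  have hss : f.IsSemisimple := Module.End.isSemisimple_of_squarefree_aeval_eq_zero hsq (by
    simp [hf])
  have htop := hss.iSup_eigenspace_eq_top
  have hspan : Submodule.span ℂ {v | ∃ μ : ℂ, f v = μ • v} = ⊤ := by
    rw [eq_top_iff, ← htop]
    exact iSup_le fun μ v hv => Submodule.subset_span ⟨μ, Module.End.mem_eigenspace_iff.1 hv⟩
  obtain ⟨B, hB, hBspan, hli⟩ := exists_linearIndependent ℂ {v | ∃ μ : ℂ, f v = μ • v}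
  have hb₀ : ∀ i, (Module.Basis.mk hli (by rw [Subtype.range_coe, hBspan, hspan])) i = (i : E) :=
    fun i => Module.Basis.mk_apply _ _ i
  set b₀ : Module.Basis B ℂ E :=
    Module.Basis.mk hli (by rw [Subtype.range_coe, hBspan, hspan]) with hb
  set e := b₀.indexEquiv (Module.finBasis ℂ E)
  choose μ hμ using fun i : B => hB i.2
  refine ⟨b₀.reindex e, fun i => μ (e.symm i), fun i => ?_⟩
  rw [Module.Basis.reindex_apply, hb₀]
  exact hμ _

/-- The complexification of an isometry. -/
def complexMatrix (g : OrthGroup n) : Matrix (Fin n) (Fin n) ℂ :=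
  Matrix.of fun i j => (entry g i j : ℂ)

lemma complexMatrix_one : complexMatrix (1 : OrthGroup n) = 1 := by
  ext i j
  simp only [complexMatrix, Matrix.of_apply, entry_one, Matrix.one_apply]
  split_ifs <;> simp

lemma complexMatrix_mul (g h : OrthGroup n) :
    complexMatrix (g * h) = complexMatrix g * complexMatrix h := by
  ext i j
  simp [complexMatrix, Matrix.mul_apply, entry_mul]

lemma complexMatrix_pow (g : OrthGroup n) (k : ℕ) :
    complexMatrix (g ^ k) = complexMatrix g ^ k := by
  induction k with
  | zero => simp [complexMatrix_one]
  | succ k ih => rw [pow_succ, complexMatrix_mul, ih, pow_succ]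

/-- An eigenbasis of the complexification of `g` with eigenvalues `μ`. -/
structure IsEigenbasis (g : OrthGroup n) (b : Module.Basis (Fin n) ℂ (Fin n → ℂ))
    (μ : Fin n → ℂ) : Prop where
  mulVec_eq : ∀ i, (complexMatrix g).mulVec (b i) = μ i • b i

lemma exists_isEigenbasis [Finite G] (g : G) : ∃ b μ, IsEigenbasis (g : OrthGroup n) b μ := by
  have hm : Nat.card G ≠ 0 := Nat.card_pos.ne'
  have hpow : (Matrix.toLin' (complexMatrix (g : OrthGroup n))) ^ Nat.card G = 1 := by
    have h1 : (g : OrthGroup n) ^ Nat.card G = 1 := by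
      rw [← Subgroup.coe_pow, pow_card_eq_one', Subgroup.coe_one]
    rw [← Matrix.toLin'_pow, ← complexMatrix_pow, h1, complexMatrix_one, Matrix.toLin'_one]
    rfl
  have hn : Module.finrank ℂ (Fin n → ℂ) = n := by simp
  obtain ⟨b, μ, h⟩ := exists_eigenbasis hm _ hpow
  refine ⟨b.reindex (finCongr hn), fun i => μ ((finCongr hn).symm i), ⟨fun i => ?_⟩⟩
  rw [Module.Basis.reindex_apply, ← h, Matrix.toLin'_apply]

/-- The inverse in the action and the transposition on coefficient vectors cancel for an orthogonal
matrix, so an eigenvector gives a linear form with the same eigenvalue. -/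
lemma polyAct_linSubst_X {g : OrthGroup n} {b : Module.Basis (Fin n) ℂ (Fin n → ℂ)}
    {μ : Fin n → ℂ} (h : IsEigenbasis g b μ) (i : Fin n) :
    polyAct g (linSubst (Matrix.of fun i j => b i j) (X i)) =
      C (μ i) * linSubst (Matrix.of fun i j => b i j) (X i) := by
  have hC : ∀ a : ℂ, polyAct g (C a) = C a := fun a => (polyAct g).commutes a
  simp only [linSubst_X, Matrix.of_apply, map_sum, map_mul, hC, polyAct_X, Finset.mul_sum]
  rw [Finset.sum_comm]
  refine Finset.sum_congr rfl fun j _ => ?_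
  have h1 := congrFun (h.mulVec_eq i) j
  rw [Matrix.mulVec, dotProduct, Pi.smul_apply, smul_eq_mul] at h1
  rw [← mul_assoc, ← C_mul, ← h1, map_sum, Finset.sum_mul]
  refine Finset.sum_congr rfl fun l _ => ?_
  rw [entry_inv, complexMatrix, Matrix.of_apply, C_mul]
  ring

/-- The trace on homogeneous polynomials in terms of eigenvalues. -/
lemma trace_degAct_eq_sum {g : OrthGroup n} {b : Module.Basis (Fin n) ℂ (Fin n → ℂ)}
    {μ : Fin n → ℂ} (h : IsEigenbasis g b μ) (k : ℕ) :
    LinearMap.trace ℂ _ (degAct g k) =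
      ∑ s ∈ (Finset.univ : Finset (Fin n)).finsuppAntidiag k, ∏ i, μ i ^ s i := by
  classical
  set P : Matrix (Fin n) (Fin n) ℂ := Matrix.of fun i j => b i j with hP
  obtain ⟨Q, hPQ, hQP⟩ : ∃ Q, P * Q = 1 ∧ Q * P = 1 := by
    have hPt : P = ((Pi.basisFun ℂ (Fin n)).toMatrix b).transpose := by
      ext i j
      simp [hP, Module.Basis.toMatrix_apply]
    refine ⟨(b.toMatrix (Pi.basisFun ℂ (Fin n))).transpose, ?_, ?_⟩
    · rw [hPt, ← Matrix.transpose_mul, Module.Basis.toMatrix_mul_toMatrix_flip,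
        Matrix.transpose_one]
    · rw [hPt, ← Matrix.transpose_mul, Module.Basis.toMatrix_mul_toMatrix_flip,
        Matrix.transpose_one]
  have hinv : ∀ p, linSubst P (linSubst Q p) = p := fun p => by
    rw [← AlgHom.comp_apply, linSubst_comp, hQP, linSubst_one, AlgHom.id_apply]
  have hinv' : ∀ p, linSubst Q (linSubst P p) = p := fun p => by
    rw [← AlgHom.comp_apply, linSubst_comp, hPQ, linSubst_one, AlgHom.id_apply]
  have hdeg : ∀ s : Fin n →₀ ℕ, s ∈ (Finset.univ : Finset (Fin n)).finsuppAntidiag k ↔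
      s.degree = k := fun s => by
    simp [Finset.mem_finsuppAntidiag, Finsupp.degree_eq_sum]
  -- Monomials in the eigenforms: an eigenbasis in degree `k`, with products of the `μ i` as
  -- eigenvalues.
  set v : (Finset.univ : Finset (Fin n)).finsuppAntidiag k → homogeneousSubmodule (Fin n) ℂ k :=
    fun s => ⟨linSubst P (monomial s.1 1),
      isHomogeneous_linSubst P (isHomogeneous_monomial _ ((hdeg _).1 s.2))⟩ with hv
  have hli : LinearIndependent ℂ v := by
    refine LinearIndependent.of_comp (Submodule.subtype _) ?_
    have h1 : LinearIndependent ℂ fun s : (Finset.univ : Finset (Fin n)).finsuppAntidiag k =>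
        (monomial s.1 1 : Poly n) := by
      have := (basisMonomials (Fin n) ℂ).linearIndependent.comp
        (fun s : (Finset.univ : Finset (Fin n)).finsuppAntidiag k => s.1) Subtype.val_injective
      simpa [Function.comp_def] using this
    exact h1.map' (linSubst P).toLinearMap
      (LinearMap.ker_eq_bot_of_injective (Function.LeftInverse.injective hinv'))
  have hspan : ⊤ ≤ Submodule.span ℂ (Set.range v) := by
    rintro ⟨p, hp⟩ -
    have hq := isHomogeneous_linSubst Q hp
    have h1 : (⟨p, hp⟩ : homogeneousSubmodule (Fin n) ℂ k) =
        ∑ s ∈ (linSubst Q p).support.attach, coeff s.1 (linSubst Q p) • v ⟨s.1, (hdeg _).2 (by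
          by_contra hne
          exact mem_support_iff.1 s.2 (hq.coeff_eq_zero hne))⟩ := by
      refine Subtype.ext ?_
      rw [Submodule.coe_sum]
      simp only [Submodule.coe_smul, hv]
      rw [Finset.sum_attach (linSubst Q p).support
        fun s => coeff s (linSubst Q p) • linSubst P (monomial s 1)]
      conv_lhs => rw [← hinv p, (linSubst Q p).as_sum, map_sum]
      refine Finset.sum_congr rfl fun s _ => ?_
      rw [← map_smul, smul_monomial, smul_eq_mul, mul_one]
    rw [h1]
    exact sum_mem fun s _ => Submodule.smul_mem _ _ (Submodule.subset_span ⟨_, rfl⟩)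
  rw [trace_eq_sum_of_basis (Module.Basis.mk hli hspan) (degAct g k)
    (fun s => ∏ i, μ i ^ s.1 i) fun s => ?_]
  · exact Finset.sum_coe_sort _ fun s : Fin n →₀ ℕ => ∏ i, μ i ^ s i
  · rw [Module.Basis.mk_apply]
    refine Subtype.ext ?_
    rw [coe_degAct_apply, Submodule.coe_smul]
    simp only [hv]
    rw [monomial_eq, C_1, one_mul, Finsupp.prod_fintype _ _ (by simp), map_prod, map_prod,
      ← C_mul', map_prod, ← Finset.prod_mul_distrib]
    refine Finset.prod_congr rfl fun i _ => ?_
    rw [map_pow, map_pow, polyAct_linSubst_X h, mul_pow, map_pow]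

/-! ### Eigenvalues of reflections and of other isometries -/

lemma orthGroup_ext {g : OrthGroup n} (h : ∀ i j, entry g i j = if i = j then 1 else 0) :
    g = 1 := by
  refine LinearIsometryEquiv.ext fun x => ?_
  ext i
  rw [apply_eq_sum_entry]
  simp [h]

lemma IsEigenbasis.exists_ne_one {g : OrthGroup n} {b : Module.Basis (Fin n) ℂ (Fin n → ℂ)}
    {μ : Fin n → ℂ} (h : IsEigenbasis g b μ) (hg : g ≠ 1) : ∃ i, μ i ≠ 1 := by
  by_contra! hcon
  apply hg
  have h1 : Matrix.toLin' (complexMatrix g) = LinearMap.id := b.ext fun i => by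
    rw [Matrix.toLin'_apply, h.mulVec_eq, hcon, one_smul, LinearMap.id_apply]
  rw [← Matrix.toLin'_one] at h1
  have h2 := Matrix.toLin'.injective h1
  refine orthGroup_ext fun i j => ?_
  have := congrFun (congrFun h2 i) j
  rw [complexMatrix, Matrix.of_apply, Matrix.one_apply] at this
  split_ifs at this ⊢ with hij
  · exact Complex.ofReal_eq_one.1 this
  · exact Complex.ofReal_eq_zero.1 this

lemma isEigenbasis_one : IsEigenbasis (1 : OrthGroup n) (Pi.basisFun ℂ (Fin n)) 1 :=
  ⟨fun i => by rw [complexMatrix_one, Matrix.one_mulVec, Pi.one_apply, one_smul]⟩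

/-- Preservation of the norm forces `φ` to vanish on the complement of `w` and `φ w` to be 0 or -2.
The value 0 would give the identity. -/
lemma isReflection_of_sub_eq_smul {g : OrthGroup n} (hg : g ≠ 1) {w : Euc n} (hw : w ≠ 0)
    (φ : Euc n → ℝ) (h : ∀ x, g x = x + φ x • w) : IsReflection g := by
  have hw2 : inner ℝ w w ≠ 0 := inner_self_ne_zero.2 hw
  have hperp : ∀ y, inner ℝ w y = 0 → g y = y := fun y hy => by
    have h1 : inner ℝ (g y) (g y) = inner ℝ y y := g.inner_map_map y y
    rw [h, inner_add_left, inner_add_right, inner_add_right, real_inner_smul_left,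
      real_inner_smul_right, real_inner_smul_left, real_inner_smul_right, hy,
      real_inner_comm w y, hy] at h1
    have h2 : φ y * (φ y * inner ℝ w w) = 0 := by linarith
    have h3 : φ y = 0 := by simpa [hw] using h2
    rw [h, h3, zero_smul, add_zero]
  have hdec : ∀ x, g x = x + (inner ℝ w x / inner ℝ w w) • (g w - w) := fun x => by
    have h1 : g (x - (inner ℝ w x / inner ℝ w w) • w) = x - (inner ℝ w x / inner ℝ w w) • w := by
      apply hperp
      rw [inner_sub_right, real_inner_smul_right, div_mul_cancel₀ _ hw2, sub_self]
    rw [map_sub, map_smul, sub_eq_iff_eq_add] at h1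
    rw [h1, smul_sub]
    abel
  have h1 : inner ℝ (g w) (g w) = inner ℝ w w := g.inner_map_map w w
  rw [h, inner_add_left, inner_add_right, inner_add_right, real_inner_smul_left,
      real_inner_smul_right, real_inner_smul_left, real_inner_smul_right] at h1
  have h2 : φ w * (φ w + 2) = 0 := by
    apply mul_right_cancel₀ hw2
    linarith
  rcases mul_eq_zero.1 h2 with h0 | h0
  · refine absurd (LinearIsometryEquiv.ext fun x => ?_) hg
    rw [hdec, h w, h0]
    simp
  · refine ⟨w, hw, LinearIsometryEquiv.ext fun x => ?_⟩
    rw [hdec, h w, eq_neg_of_add_eq_zero_left h0, reflection_apply_eq,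
      ← real_inner_self_eq_norm_sq]
    module

/-- Over `ℂ` the operator `g - 1` has rank at most one, so the 2 × 2 minors of its real matrix `d`
vanish. A nonzero column of `d` is then a real vector along which `g` moves every point. -/
lemma IsEigenbasis.isReflection {g : OrthGroup n} {b : Module.Basis (Fin n) ℂ (Fin n → ℂ)}
    {μ : Fin n → ℂ} (h : IsEigenbasis g b μ) (hg : g ≠ 1) {i : Fin n}
    (h1 : ∀ j, j ≠ i → μ j = 1) : IsReflection g := by
  set d : Fin n → Fin n → ℝ := fun k j => entry g k j - if k = j then 1 else 0 with hd
  have hcol : ∀ x : Fin n → ℂ, (complexMatrix g).mulVec x = x + (b.repr x i * (μ i - 1)) • b i := by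
    intro x
    have key : Matrix.toLin' (complexMatrix g) =
        LinearMap.id + ((μ i - 1) • (b.coord i)).smulRight (b i) := b.ext fun j => by
      rw [Matrix.toLin'_apply, h.mulVec_eq]
      rcases eq_or_ne j i with rfl | hj
      · simp [sub_smul]
      · simp [h1 j hj, hj]
    have := LinearMap.congr_fun key x
    rw [Matrix.toLin'_apply] at this
    rw [this]
    simp [mul_comm]
  have hdc : ∀ k j, (d k j : ℂ) = b.repr (Pi.single j 1) i * (μ i - 1) * b i k := fun k j => by
    have := congrFun (hcol (Pi.single j 1)) k
    rw [Matrix.mulVec_single_one, Matrix.col_apply, complexMatrix, Matrix.of_apply, Pi.add_apply,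
      Pi.smul_apply, smul_eq_mul, Pi.single_apply] at this
    simp only [hd]
    rw [Complex.ofReal_sub, this]
    split_ifs <;> simp
  have hminor : ∀ k j k' j', d k j * d k' j' = d k' j * d k j' := fun k j k' j' => by
    have : (d k j : ℂ) * d k' j' = d k' j * d k j' := by
      simp only [hdc]; ring
    exact_mod_cast this
  obtain ⟨k₀, j₀, h0⟩ : ∃ k j, d k j ≠ 0 := by
    by_contra! hcon
    exact hg (orthGroup_ext fun k j => sub_eq_zero.1 (hcon k j))
  have hgx : ∀ x k, g x k = x k + ∑ j, d k j * x j := fun x k => by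
    rw [apply_eq_sum_entry]
    simp [hd, sub_mul, Finset.sum_sub_distrib]
  refine isReflection_of_sub_eq_smul hg (w := WithLp.toLp 2 fun k => d k j₀) (fun hw => h0 ?_)
    (fun x => ∑ j, d k₀ j / d k₀ j₀ * x j) fun x => ?_
  · exact congrFun (congrArg WithLp.ofLp hw) k₀
  · ext k
    rw [hgx, PiLp.add_apply, PiLp.smul_apply, smul_eq_mul, Finset.sum_mul]
    congr 1
    refine Finset.sum_congr rfl fun j _ => ?_
    have := hminor k j k₀ j₀
    field_simp
    linear_combination x j * this

lemma IsReflection.ne_one {g : OrthGroup n} (hg : IsReflection g) : g ≠ 1 := by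
  obtain ⟨v, hv, rfl⟩ := hg
  intro he
  have := Submodule.reflection_orthogonalComplement_singleton_eq_neg (𝕜 := ℝ) v
  rw [he] at this
  change v = -v at this
  rw [eq_neg_iff_add_eq_zero, ← two_smul ℝ] at this
  exact hv ((smul_eq_zero.1 this).resolve_left two_ne_zero)

/-- An eigenvector with eigenvalue different from 1 lies in the image of `g - 1`, the line of the
normal vector, on which `g` is -1. A basis has at most one member on a line. -/
lemma IsEigenbasis.of_isReflection {g : OrthGroup n} {b : Module.Basis (Fin n) ℂ (Fin n → ℂ)}
    {μ : Fin n → ℂ} (h : IsEigenbasis g b μ) (hg : IsReflection g) :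
    ∃ i, μ i = -1 ∧ ∀ j, j ≠ i → μ j = 1 := by
  have hg1 := hg.ne_one
  obtain ⟨v, hv, rfl⟩ := hg
  set w : Fin n → ℂ := fun j => (v j : ℂ) with hw
  have hmul : ∀ c : Fin n → ℂ, (complexMatrix (ℝ ∙ v)ᗮ.reflection).mulVec c =
      c - (2 * (∑ j, v j * c j) / (‖v‖ : ℂ) ^ 2) • w := fun c => by
    ext i
    rw [Matrix.mulVec, dotProduct]
    have : ∀ j, complexMatrix (ℝ ∙ v)ᗮ.reflection i j =
        (if i = j then 1 else 0) - 2 * (v j : ℂ) * v i / (‖v‖ : ℂ) ^ 2 := fun j => by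
      rw [complexMatrix, Matrix.of_apply, entry, reflection_apply_eq,
        EuclideanSpace.inner_single_right]
      simp [apply_ite]
      ring
    simp only [this, sub_mul, Finset.sum_sub_distrib, Pi.sub_apply, Pi.smul_apply, smul_eq_mul, hw,
      Finset.mul_sum, Finset.sum_mul, Finset.sum_div]
    congr 1
    · simp
    · exact Finset.sum_congr rfl fun j _ => by ring
  have hpar : ∀ i, μ i ≠ 1 → ∃ c : ℂ, c ≠ 0 ∧ b i = c • w := fun i hi => by
    have h1 := h.mulVec_eq i
    rw [hmul, sub_eq_iff_eq_add, ← sub_eq_iff_eq_add'] at h1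
    have h2 : (1 - μ i) • b i = (2 * (∑ j, v j * b i j) / (‖v‖ : ℂ) ^ 2) • w := by
      rw [sub_smul, one_smul, h1]
    have h3 : (1 - μ i) ≠ 0 := sub_ne_zero.2 hi.symm
    refine ⟨(1 - μ i)⁻¹ * (2 * (∑ j, v j * b i j) / (‖v‖ : ℂ) ^ 2), fun hc => ?_, ?_⟩
    · refine b.ne_zero i ?_
      rw [← inv_smul_smul₀ h3 (b i), h2, smul_smul, hc, zero_smul]
    · rw [mul_smul, ← h2, inv_smul_smul₀ h3]
  obtain ⟨i, hi⟩ := h.exists_ne_one hg1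
  obtain ⟨c, hc, hbi⟩ := hpar i hi
  refine ⟨i, ?_, fun j hj => ?_⟩
  · have h1 := h.mulVec_eq i
    have hvw : ∑ j, (v j : ℂ) * w j = (‖v‖ : ℂ) ^ 2 := by
      rw [← Complex.ofReal_pow, EuclideanSpace.norm_sq_eq]
      push_cast
      simp [hw, ← sq, ← Complex.ofReal_pow]
    have hv2 : (‖v‖ : ℂ) ^ 2 ≠ 0 := by simpa using hv
    have h2 : (complexMatrix (ℝ ∙ v)ᗮ.reflection).mulVec w = -w := by
      rw [hmul, hvw, mul_div_cancel_right₀ _ hv2, two_smul]; abel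
    rw [hbi, Matrix.mulVec_smul, h2, smul_comm] at h1
    have h3 := smul_right_injective _ hc h1
    have hw0 : w ≠ 0 := fun h0 => b.ne_zero i (by rw [hbi, h0, smul_zero])
    have h4 : (μ i + 1) • w = 0 := by
      rw [add_smul, one_smul, ← h3, neg_add_cancel]
    exact eq_neg_of_add_eq_zero_left ((smul_eq_zero.1 h4).resolve_right hw0)
  · by_contra hj1
    obtain ⟨c', hc', hbj⟩ := hpar j hj1
    apply hj
    have h1 : b j = (c' * c⁻¹) • b i := by
      rw [hbj, hbi, smul_smul, inv_mul_cancel_right₀ hc]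
    have h2 := congrArg (fun x => b.repr x j) h1
    by_contra hji
    simp [Ne.symm hji] at h2

/-! ### Graded characters of the harmonic polynomials -/

lemma character_harmonicRep_eq_zero [Finite G] (g : G) {k : ℕ} (hk : n * Nat.card G < k) :
    (harmonicRep G k).character g = 0 := by
  have : Subsingleton (harmonicDeg G k) := by
    rw [harmonicDeg_eq_bot hk]; infer_instance
  have h0 : harmonicRep G k g = 0 := LinearMap.ext fun x => Subsingleton.elim _ _
  rw [Representation.character, h0, map_zero]

/-- The graded character `∑ k, tr(g | H^k) t ^ k` of the harmonic polynomials. -/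
def gradedCharacter (g : G) : Polynomial ℂ :=
  ∑ k ∈ Finset.range (n * Nat.card G + 1), Polynomial.monomial k ((harmonicRep G k).character g)

lemma coeff_gradedCharacter [Finite G] (g : G) (k : ℕ) :
    (gradedCharacter g).coeff k = (harmonicRep G k).character g := by
  rw [gradedCharacter, Polynomial.finsetSum_coeff]
  simp only [Polynomial.coeff_monomial, Finset.sum_ite_eq', Finset.mem_range]
  split_ifs with h
  · rfl
  · rw [character_harmonicRep_eq_zero g (by omega)]

/-- The Hilbert series of the invariants. -/
def invariantSeries (G : Subgroup (OrthGroup n)) : PowerSeries ℂ :=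
  PowerSeries.mk fun k => (Module.finrank ℂ (invariantDeg G k) : ℂ)

lemma mk_trace_degAct (hG : IsReflectionGroup G) (g : G) :
    PowerSeries.mk (fun k => LinearMap.trace ℂ _ (degAct (g : OrthGroup n) k)) =
      invariantSeries G * (gradedCharacter g : PowerSeries ℂ) := by
  have := hG.finite
  ext k
  rw [PowerSeries.coeff_mk, trace_degAct hG, PowerSeries.coeff_mul]
  refine Finset.sum_congr rfl fun x _ => ?_
  rw [invariantSeries, PowerSeries.coeff_mk, Polynomial.coeff_coe, coeff_gradedCharacter]

/-- The polynomial `∏ i, (1 - μ i t)`. -/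
def eigenPoly (μ : Fin n → ℂ) : Polynomial ℂ :=
  ∏ i, (1 - Polynomial.C (μ i) * Polynomial.X)

lemma mk_trace_degAct_mul_eigenPoly {g : OrthGroup n}
    {b : Module.Basis (Fin n) ℂ (Fin n → ℂ)} {μ : Fin n → ℂ} (h : IsEigenbasis g b μ) :
    PowerSeries.mk (fun k => LinearMap.trace ℂ _ (degAct g k)) * (eigenPoly μ : PowerSeries ℂ) =
      1 := by
  classical
  have h1 : PowerSeries.mk (fun k => LinearMap.trace ℂ _ (degAct g k)) =
      ∏ i, PowerSeries.mk fun k => μ i ^ k := by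
    ext k
    rw [PowerSeries.coeff_mk, trace_degAct_eq_sum h, PowerSeries.coeff_prod]
    simp
  have h2 : (eigenPoly μ : PowerSeries ℂ) = ∏ i, (1 - PowerSeries.C (μ i) * PowerSeries.X) := by
    rw [eigenPoly, ← Polynomial.coeToPowerSeries.ringHom_apply, map_prod]
    simp
  rw [h1, h2, ← Finset.prod_mul_distrib]
  refine Finset.prod_eq_one fun i _ => ?_
  ext k
  rw [mul_sub, mul_one, map_sub, mul_left_comm, PowerSeries.coeff_C_mul]
  cases k with
  | zero => simp
  | succ k =>
    rw [PowerSeries.coeff_succ_mul_X, PowerSeries.coeff_mk, PowerSeries.coeff_mk, pow_succ']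
    simp [PowerSeries.coeff_one]

/-- The graded character times the characteristic polynomial does not depend on the group
element. -/
lemma gradedCharacter_mul_eigenPoly (hG : IsReflectionGroup G) {g : G}
    {b : Module.Basis (Fin n) ℂ (Fin n → ℂ)} {μ : Fin n → ℂ}
    (h : IsEigenbasis (g : OrthGroup n) b μ) :
    gradedCharacter g * eigenPoly μ = gradedCharacter (1 : G) * (1 - Polynomial.X) ^ n := by
  have h1 := mk_trace_degAct_mul_eigenPoly h
  have h2 := mk_trace_degAct_mul_eigenPoly (isEigenbasis_one (n := n))
  rw [mk_trace_degAct hG g] at h1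
  have h4 := mk_trace_degAct hG (1 : G)
  rw [Subgroup.coe_one] at h4
  rw [h4] at h2
  have h5 : eigenPoly (1 : Fin n → ℂ) = (1 - Polynomial.X) ^ n := by
    simp [eigenPoly]
  rw [← h5]
  apply Polynomial.coe_injective
  rw [Polynomial.coe_mul, Polynomial.coe_mul]
  -- The Hilbert series of the invariants is a common factor for `g` and for 1, so it cancels
  -- without being known.
  have hne : invariantSeries G ≠ 0 := fun h0 => by
    rw [h0, zero_mul, zero_mul] at h1
    exact zero_ne_one h1
  apply mul_left_cancel₀ hne
  rw [← mul_assoc, ← mul_assoc, h1, h2]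

open Classical in
lemma eigenPoly_eq (μ : Fin n → ℂ) : ∃ E : Polynomial ℂ,
    E = (∏ i with μ i ≠ 1, (1 - Polynomial.C (μ i) * Polynomial.X)) ∧ E.eval 1 ≠ 0 ∧
    eigenPoly μ = (1 - Polynomial.X) ^ (n - (Finset.univ.filter fun i => μ i ≠ 1).card) * E := by
  refine ⟨_, rfl, ?_, ?_⟩
  · rw [Polynomial.eval_prod, Finset.prod_ne_zero_iff]
    intro i hi
    have := (Finset.mem_filter.1 hi).2
    simpa [sub_eq_zero] using this.symm
  · rw [eigenPoly, ← Finset.prod_filter_mul_prod_filter_not Finset.univ (fun i => μ i = 1)]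
    congr 1
    rw [Finset.prod_congr rfl (g := fun _ => (1 - Polynomial.X)) fun i hi => by
      rw [(Finset.mem_filter.1 hi).2, Polynomial.C_1, one_mul], Finset.prod_const]
    congr 1
    have := Finset.card_filter_add_card_filter_not (s := (Finset.univ : Finset (Fin n)))
      (fun i => μ i = 1)
    rw [Finset.card_univ, Fintype.card_fin] at this
    exact Nat.eq_sub_of_add_eq this

-- After cancelling one factor `1 - X` for each eigenvalue 1, the product on the left no longer
-- vanishes at 1. The exponent on the right thus bounds from below the order of vanishing of the
-- graded character there.
open Classical in
lemma gradedCharacter_mul_eq (hG : IsReflectionGroup G) {g : G}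
    {b : Module.Basis (Fin n) ℂ (Fin n → ℂ)} {μ : Fin n → ℂ}
    (h : IsEigenbasis (g : OrthGroup n) b μ) :
    gradedCharacter g * (∏ i with μ i ≠ 1, (1 - Polynomial.C (μ i) * Polynomial.X)) =
      gradedCharacter (1 : G) * (1 - Polynomial.X) ^ (Finset.univ.filter fun i => μ i ≠ 1).card := by
  obtain ⟨E, hE, -, hE2⟩ := eigenPoly_eq μ
  have h1 := gradedCharacter_mul_eigenPoly hG h
  rw [← hE]
  have hcard : (Finset.univ.filter fun i => μ i ≠ 1).card ≤ n := by
    simpa using Finset.card_filter_le (Finset.univ : Finset (Fin n)) fun i => μ i ≠ 1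
  have hX : (1 - Polynomial.X : Polynomial ℂ) ≠ 0 := fun h0 => by
    have := congrArg (Polynomial.eval 0) h0
    simp at this
  apply mul_left_cancel₀ (pow_ne_zero (n - (Finset.univ.filter fun i => μ i ≠ 1).card) hX)
  rw [mul_left_comm, ← hE2, h1, mul_left_comm, ← pow_add, Nat.sub_add_cancel hcard]

lemma eval_gradedCharacter_of_ne_one (hG : IsReflectionGroup G) {g : G} (hg : g ≠ 1) : (gradedCharacter g).eval 1 = 0 := by
  classical
  have := hG.finite
  obtain ⟨b, μ, h⟩ := exists_isEigenbasis g
  obtain ⟨i, hi⟩ := h.exists_ne_one (by simpa using hg)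
  obtain ⟨E, hE, hE1, -⟩ := eigenPoly_eq μ
  have h1 := congrArg (Polynomial.eval 1) (gradedCharacter_mul_eq hG h)
  rw [← hE] at h1
  have hc : (Finset.univ.filter fun i => μ i ≠ 1).card ≠ 0 :=
    Finset.card_ne_zero_of_mem (Finset.mem_filter.2 ⟨Finset.mem_univ i, hi⟩)
  simpa [hE1, hc] using h1

/-- At least two eigenvalues differ from 1, so the zero at 1 is at least double. -/
lemma eval_derivative_gradedCharacter_of_not_isReflection (hG : IsReflectionGroup G) {g : G} (hg : g ≠ 1)
    (hr : ¬ IsReflection (g : OrthGroup n)) : (gradedCharacter g).derivative.eval 1 = 0 := by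
  classical
  have := hG.finite
  have hg1 : (g : OrthGroup n) ≠ 1 := by simpa using hg
  obtain ⟨b, μ, h⟩ := exists_isEigenbasis g
  obtain ⟨i, hi⟩ := h.exists_ne_one hg1
  obtain ⟨j, hji, hj⟩ : ∃ j, j ≠ i ∧ μ j ≠ 1 := by
    by_contra! hcon
    exact hr (h.isReflection hg1 hcon)
  obtain ⟨E, hE, hE1, -⟩ := eigenPoly_eq μ
  have h1 := congrArg (fun p => (Polynomial.derivative p).eval 1) (gradedCharacter_mul_eq hG h)
  rw [← hE] at h1
  have hc : 1 < (Finset.univ.filter fun i => μ i ≠ 1).card :=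
    Finset.one_lt_card.2 ⟨i, by simpa using hi, j, by simpa using hj, hji.symm⟩
  have hc0 : (Finset.univ.filter fun i => μ i ≠ 1).card ≠ 0 := by omega
  have hc1 : (Finset.univ.filter fun i => μ i ≠ 1).card - 1 ≠ 0 := by omega
  simpa [Polynomial.derivative_mul, Polynomial.derivative_pow, hE1, hc0, hc1,
    eval_gradedCharacter_of_ne_one hG hg] using h1

/-- The identity reads `H_g(t) (1 + t) = H_1(t) (1 - t)`; differentiate at 1 and use `H_g(1) = 0`.
-/
lemma eval_derivative_gradedCharacter_of_isReflection (hG : IsReflectionGroup G) {g : G}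
    (hr : IsReflection (g : OrthGroup n)) :
    (gradedCharacter g).derivative.eval 1 = -((gradedCharacter (1 : G)).eval 1 / 2) := by
  classical
  have := hG.finite
  obtain ⟨b, μ, h⟩ := exists_isEigenbasis g
  obtain ⟨i, hi, hj⟩ := h.of_isReflection hr
  have hg : g ≠ 1 := fun h => hr.ne_one (congrArg Subtype.val h)
  have hfilter : (Finset.univ.filter fun i => μ i ≠ 1) = {i} := by
    ext j
    simp only [Finset.mem_filter, Finset.mem_univ, true_and, Finset.mem_singleton]
    constructor
    · intro h1
      by_contra hne
      exact h1 (hj j hne)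
    · rintro rfl
      rw [hi]; norm_num
  have h1 := congrArg (fun p => (Polynomial.derivative p).eval 1) (gradedCharacter_mul_eq hG h)
  rw [hfilter] at h1
  simp [Polynomial.derivative_mul, hi, eval_gradedCharacter_of_ne_one hG hg] at h1
  linear_combination (1 / 2) * h1

/-! ### The character attached to a class of reflections -/

lemma isReflection_iff_exists_unit {g : OrthGroup n} :
    IsReflection g ↔ ∃ v : Euc n, ‖v‖ = 1 ∧ g = (ℝ ∙ v)ᗮ.reflection := by
  constructor
  · rintro ⟨v, hv, rfl⟩
    have hv' : ‖v‖ ≠ 0 := norm_ne_zero_iff.2 hv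
    refine ⟨‖v‖⁻¹ • v, by rw [norm_smul, norm_inv, norm_norm, inv_mul_cancel₀ hv'],
      LinearIsometryEquiv.ext fun x => ?_⟩
    rw [reflection_apply_eq, reflection_apply_eq, norm_smul, norm_inv, norm_norm,
      inv_mul_cancel₀ hv', real_inner_smul_left, smul_smul]
    congr 2
    field_simp
  · rintro ⟨v, hv, rfl⟩
    exact ⟨v, fun h0 => by simp [h0] at hv, rfl⟩

lemma mul_reflection_mul_inv (g : OrthGroup n) (v : Euc n) :
    g * (ℝ ∙ v)ᗮ.reflection * g⁻¹ = (ℝ ∙ g v)ᗮ.reflection := by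
  refine LinearIsometryEquiv.ext fun x => ?_
  have hx : g (g⁻¹ x) = x := g.apply_symm_apply x
  change g ((ℝ ∙ v)ᗮ.reflection (g⁻¹ x)) = _
  rw [reflection_apply_eq, reflection_apply_eq, map_sub, map_smul, hx, g.norm_map]
  conv_rhs => rw [← hx, g.inner_map_map, hx]

lemma IsReflection.conj {r : OrthGroup n} (hr : IsReflection r) (g : OrthGroup n) :
    IsReflection (g * r * g⁻¹) := by
  obtain ⟨v, hv, rfl⟩ := hr
  exact ⟨g v, fun h => hv (by simpa using h), mul_reflection_mul_inv g v⟩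

lemma IsReflection.of_isConj {s r : G} (hs : IsReflection (s : OrthGroup n)) (h : IsConj s r) :
    IsReflection (r : OrthGroup n) := by
  obtain ⟨g, rfl⟩ := isConj_iff.1 h
  exact hs.conj g

lemma IsReflection.mul_self {r : OrthGroup n} (hr : IsReflection r) : r * r = 1 := by
  obtain ⟨v, -, rfl⟩ := hr
  exact Submodule.reflection_mul_reflection _

lemma eq_inner_smul_of_reflection_eq_neg {v w : Euc n} (hv : ‖v‖ = 1)
    (h : (ℝ ∙ v)ᗮ.reflection w = -w) : w = (inner ℝ v w : ℝ) • v := by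
  rw [reflection_apply_eq, hv, one_pow, div_one, sub_eq_iff_eq_add, ← sub_eq_iff_eq_add',
    sub_neg_eq_add, ← two_smul ℝ, mul_smul] at h
  exact smul_right_injective _ two_ne_zero h

lemma inner_mul_inner_of_eq_smul {v w : Euc n} (hv : ‖v‖ = 1) (hw : ‖w‖ = 1)
    (h : w = (inner ℝ v w : ℝ) • v) : (inner ℝ v w : ℝ) * inner ℝ v w = 1 := by
  have h1 : inner ℝ w w = (1 : ℝ) := by rw [real_inner_self_eq_norm_sq, hw, one_pow]
  have h2 : inner ℝ v v = (1 : ℝ) := by rw [real_inner_self_eq_norm_sq, hv, one_pow]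
  rw [h] at h1
  rw [real_inner_smul_left, real_inner_smul_right, h2, mul_one] at h1
  exact h1

lemma reflection_eq_of_eq_smul {v w : Euc n} {c : ℝ} (hc : c ≠ 0) (h : w = c • v) :
    (ℝ ∙ w)ᗮ.reflection = (ℝ ∙ v)ᗮ.reflection := by
  subst h
  refine LinearIsometryEquiv.ext fun x => ?_
  rw [reflection_apply_eq, reflection_apply_eq, norm_smul, real_inner_smul_left, smul_smul,
    mul_pow, Real.norm_eq_abs, sq_abs]
  congr 2
  rcases eq_or_ne v 0 with rfl | hv
  · simp
  · have : ‖v‖ ≠ 0 := norm_ne_zero_iff.2 hv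
    field_simp

/-- The product of the signs by which `g` permutes chosen unit normals of the reflections in the
class of `s` is the character attached to that class. -/
lemma exists_isClassCharacter [Finite G] (s : G) (hs : IsReflection (s : OrthGroup n)) :
    ∃ χ : G →* ℂˣ, IsClassCharacter s χ := by
  classical
  cases nonempty_fintype G
  have hex : ∀ r : G, ∃ v : Euc n, IsReflection (r : OrthGroup n) →
      ‖v‖ = 1 ∧ (r : OrthGroup n) = (ℝ ∙ v)ᗮ.reflection := fun r => by
    by_cases hr : IsReflection (r : OrthGroup n)
    · obtain ⟨v, hv⟩ := isReflection_iff_exists_unit.1 hr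
      exact ⟨v, fun _ => hv⟩
    · exact ⟨0, fun h => absurd h hr⟩
  choose v hv using hex
  set T : Finset G := Finset.univ.filter (IsConj s) with hT
  have hTr : ∀ r ∈ T, IsReflection (r : OrthGroup n) := fun r hr =>
    hs.of_isConj (Finset.mem_filter.1 hr).2
  have hTconj : ∀ g r : G, r ∈ T ↔ g * r * g⁻¹ ∈ T := fun g r => by
    simp only [hT, Finset.mem_filter, Finset.mem_univ, true_and]
    have : IsConj r (g * r * g⁻¹) := isConj_iff.2 ⟨g, rfl⟩
    exact ⟨fun h => h.trans this, fun h => h.trans this.symm⟩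
  -- For `r` in the class both vectors are unit normals of the same hyperplane, so their inner
  -- product is the sign relating them.
  set ε : G → G → ℝ := fun g r => inner ℝ (v (g * r * g⁻¹)) ((g : OrthGroup n) (v r)) with hε
  have hact : ∀ g r : G, r ∈ T → (g : OrthGroup n) (v r) = ε g r • v (g * r * g⁻¹) ∧
      ε g r * ε g r = 1 := fun g r hr => by
    obtain ⟨h1, h2⟩ := hv r (hTr r hr)
    obtain ⟨h3, h4⟩ := hv _ (hTr _ ((hTconj g r).1 hr))
    have h5 : (ℝ ∙ (v (g * r * g⁻¹)))ᗮ.reflection ((g : OrthGroup n) (v r)) =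
        -(g : OrthGroup n) (v r) := by
      have h6 : ((g * r * g⁻¹ : G) : OrthGroup n) = (ℝ ∙ (g : OrthGroup n) (v r))ᗮ.reflection := by
        rw [← mul_reflection_mul_inv, ← h2]; rfl
      rw [← h4, h6, Submodule.reflection_orthogonalComplement_singleton_eq_neg]
    have h7 := eq_inner_smul_of_reflection_eq_neg h3 h5
    exact ⟨h7, inner_mul_inner_of_eq_smul h3 (by rw [LinearIsometryEquiv.norm_map, h1]) h7⟩
  have huniq : ∀ r ∈ T, ∀ a b : ℝ, a • v r = b • v r → a = b := fun r hr a b h => by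
    refine smul_left_injective ℝ (fun h0 => ?_) h
    have := (hv r (hTr r hr)).1
    rw [h0, norm_zero] at this
    exact zero_ne_one this
  have hcocycle : ∀ g h r : G, r ∈ T → ε (g * h) r = ε h r * ε g (h * r * h⁻¹) := fun g h r hr => by
    have hr' := (hTconj h r).1 hr
    have he : g * h * r * (g * h)⁻¹ = g * (h * r * h⁻¹) * g⁻¹ := by group
    refine huniq (g * (h * r * h⁻¹) * g⁻¹) ((hTconj g _).1 hr') _ _ ?_
    have h1 := (hact (g * h) r hr).1
    rw [he] at h1
    rw [← h1, mul_smul, ← (hact g _ hr').1, ← map_smul, ← (hact h r hr).1]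
    rfl
  have hone : ∀ r ∈ T, ε 1 r = 1 := fun r hr => by
    refine huniq r hr _ _ ?_
    have h1 := (hact 1 r hr).1
    rw [one_mul, inv_one, mul_one] at h1
    rw [← h1, one_smul]
    rfl
  set χ₀ : G →* ℝ :=
    { toFun := fun g => ∏ r ∈ T, ε g r
      map_one' := Finset.prod_eq_one hone
      map_mul' := fun g h => by
        rw [Finset.prod_congr rfl (hcocycle g h), Finset.prod_mul_distrib, mul_comm]
        congr 1
        exact Finset.prod_equiv (MulAut.conj h).toEquiv (fun r => hTconj h r) fun r _ => rfl }
    with hχ₀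
  refine ⟨((Complex.ofRealHom : ℝ →* ℂ).comp χ₀).toHomUnits, fun r hr => ?_⟩
  obtain ⟨hr1, hr2⟩ := hv r hr
  have hrr : r * r = 1 := Subtype.ext hr.mul_self
  -- Conjugation by `r` is an involution; by the cocycle identity and `r * r = 1`, the signs at `x`
  -- and at its conjugate multiply to 1. At a fixed `x` the sign -1 would make the normals of `x`
  -- and `r` parallel, that is `x = r`.
  have herase : ∏ x ∈ T.erase r, ε r x = 1 := by
    refine Finset.prod_involution (fun x _ => r * x * r⁻¹) ?_ ?_ ?_ ?_
    · intro x hx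
      have hx := Finset.mem_of_mem_erase hx
      rw [← hcocycle r r x hx, hrr, hone x hx]
    · intro x hx hne he
      obtain ⟨hxr, hx⟩ := Finset.mem_erase.1 hx
      obtain ⟨h1, h2⟩ := hact r x hx
      rw [he] at h1
      have h3 : ε r x = -1 := (mul_self_eq_one_iff.1 h2).resolve_left hne
      rw [h3, neg_one_smul] at h1
      rw [hr2] at h1
      have h4 := eq_inner_smul_of_reflection_eq_neg hr1 h1
      obtain ⟨hx1, hx2⟩ := hv x (hTr x hx)
      refine hxr (Subtype.ext ?_)
      rw [hx2, hr2]
      refine reflection_eq_of_eq_smul (fun h0 => ?_) h4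
      have := inner_mul_inner_of_eq_smul hr1 hx1 h4
      rw [h0, zero_mul] at this
      exact zero_ne_one this
    · intro x hx
      obtain ⟨hxr, hx⟩ := Finset.mem_erase.1 hx
      refine Finset.mem_erase.2 ⟨fun he => hxr ?_, (hTconj r x).1 hx⟩
      rw [mul_inv_eq_iff_eq_mul] at he
      exact mul_left_cancel he
    · intro x hx
      have he : r * (r * x * r⁻¹) * r⁻¹ = (r * r) * x * (r * r)⁻¹ := by group
      simp only [he, hrr, inv_one, mul_one, one_mul]
  refine Units.ext ?_
  have hval : χ₀ r = if IsConj s r then -1 else 1 := by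
    change ∏ x ∈ T, ε r x = _
    split_ifs with hc
    · have hrT : r ∈ T := Finset.mem_filter.2 ⟨Finset.mem_univ _, hc⟩
      rw [← Finset.mul_prod_erase T _ hrT, herase, mul_one]
      refine huniq r hrT _ _ ?_
      have h1 := (hact r r hrT).1
      rw [mul_inv_cancel_right, hr2,
        Submodule.reflection_orthogonalComplement_singleton_eq_neg] at h1
      rw [← h1, neg_one_smul]
    · rw [← herase, Finset.erase_eq_of_notMem fun h => hc (Finset.mem_filter.1 h).2]
  change ((χ₀ r : ℝ) : ℂ) = _
  rw [hval]
  split_ifs <;> simp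

lemma isClassCharacter_unique (hG : IsReflectionGroup G) {s : G} {χ χ' : G →* ℂˣ}
    (h : IsClassCharacter s χ) (h' : IsClassCharacter s χ') : χ = χ' := by
  ext1 ⟨g, hg⟩
  have hg' := hg
  rw [← hG.closure_eq] at hg'
  induction hg' using Subgroup.closure_induction with
  | mem x hx => rw [h ⟨x, hg⟩ hx.2, h' ⟨x, hg⟩ hx.2]
  | one => exact (map_one χ).trans (map_one χ').symm
  | mul x y hx hy ihx ihy =>
    rw [hG.closure_eq] at hx hy
    have : (⟨x * y, hg⟩ : G) = ⟨x, hx⟩ * ⟨y, hy⟩ := rfl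
    rw [this, map_mul, map_mul, ihx hx, ihy hy]
  | inv x hx ih =>
    rw [hG.closure_eq] at hx
    have : (⟨x⁻¹, hg⟩ : G) = (⟨x, hx⟩ : G)⁻¹ := rfl
    rw [this, map_inv, map_inv, ih hx]

/-! ### Multiplicities and Poincaré polynomials -/

open Classical in
variable (G) in
/-- The reflections of a finite group. -/
def reflections [Fintype G] : Finset G :=
  Finset.univ.filter fun r : G => IsReflection (r : OrthGroup n)

lemma mem_reflections [Fintype G] {r : G} :
    r ∈ reflections G ↔ IsReflection (r : OrthGroup n) := by
  simp [reflections]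

section Multiplicity

variable {V : Type*} [AddCommGroup V] [Module ℂ V]

/-- Equivariant maps to harmonic polynomials of degree `k`, as intertwining maps. -/
def homToHarmonicEquiv (ρ : Representation ℂ G V) (k : ℕ) :
    homToHarmonic G ρ k ≃ₗ[ℂ] ρ.IntertwiningMap (harmonicRep G k) where
  toFun f := ⟨LinearMap.codRestrict _ f.1.toLinearMap f.2, fun g =>
    LinearMap.ext fun v => Subtype.ext (f.1.isIntertwining _ _ g v)⟩
  map_add' _ _ := rfl
  map_smul' _ _ := rfl
  invFun f := ⟨⟨(Submodule.subtype _).comp f.toLinearMap, fun g =>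
    LinearMap.ext fun v => congrArg Subtype.val (f.isIntertwining _ _ g v)⟩, fun v => (f v).2⟩
  left_inv _ := rfl
  right_inv _ := rfl

variable [FiniteDimensional ℂ V] (ρ : Representation ℂ G V)

lemma multiplicity_eq_sum [Fintype G] (k : ℕ) : (multiplicity G ρ k : ℂ) =
    (Nat.card G : ℂ)⁻¹ * ∑ g : G, (harmonicRep G k).character g * ρ.character g⁻¹ := by
  have : Invertible (Nat.card G : ℂ) := invertibleOfNonzero (Nat.cast_ne_zero.2 Nat.card_pos.ne')
  rw [Representation.card_inv_mul_sum_char_mul_char_eq_finrank, multiplicity,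
    (homToHarmonicEquiv ρ k).finrank_eq]

lemma multiplicity_eq_zero [Finite G] {k : ℕ} (hk : n * Nat.card G < k) :
    multiplicity G ρ k = 0 := by
  cases nonempty_fintype G
  have := multiplicity_eq_sum ρ k
  simp only [character_harmonicRep_eq_zero _ hk, zero_mul, Finset.sum_const_zero, mul_zero] at this
  exact_mod_cast this

/-- A `finsum` with infinite support would be 0 by default; the bound on the degrees of harmonic
polynomials excludes this. -/
lemma coeff_poincare [Finite G] (k : ℕ) : (poincare G ρ).coeff k = multiplicity G ρ k := by
  have hsupp : (Function.support fun k : ℕ =>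
      Polynomial.monomial k (multiplicity G ρ k : ℝ)) ⊆ Finset.range (n * Nat.card G + 1) := by
    intro k hk
    by_contra hcon
    apply hk
    rw [Finset.mem_coe, Finset.mem_range] at hcon
    simp [multiplicity_eq_zero ρ (k := k) (by omega)]
  rw [poincare, finsum_eq_sum_of_support_subset _ hsupp, Polynomial.finsetSum_coeff]
  simp only [Polynomial.coeff_monomial, Finset.sum_ite_eq', Finset.mem_range]
  split_ifs with h
  · rfl
  · rw [multiplicity_eq_zero ρ (by omega), Nat.cast_zero]

lemma map_poincare [Fintype G] : (poincare G ρ).map Complex.ofRealHom =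
    Polynomial.C (Nat.card G : ℂ)⁻¹ *
      ∑ g : G, Polynomial.C (ρ.character g⁻¹) * gradedCharacter g := by
  ext k
  rw [Polynomial.coeff_map, coeff_poincare, Polynomial.coeff_C_mul, Polynomial.finsetSum_coeff]
  simp only [Polynomial.coeff_C_mul, coeff_gradedCharacter]
  rw [map_natCast, multiplicity_eq_sum]
  simp only [mul_comm]

variable (G) in
/-- The Hilbert polynomial of the harmonic polynomials. -/
def harmonicHilbert : Polynomial ℝ :=
  ∑ k ∈ Finset.range (n * Nat.card G + 1),
    Polynomial.monomial k (Module.finrank ℂ (harmonicDeg G k) : ℝ)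

lemma gradedCharacter_one :
    gradedCharacter (1 : G) = (harmonicHilbert G).map Complex.ofRealHom := by
  simp [gradedCharacter, harmonicHilbert, Polynomial.map_sum]

lemma one_mem_harmonicDeg : (1 : Poly n) ∈ harmonicDeg G 0 := by
  refine ⟨mem_harmonic_iff_pairing.2 fun x hx => ?_, isHomogeneous_one _ _⟩
  rw [pairing_comm, pairing, ← C_1, diffOp_C, one_smul, Module.End.one_apply,
    constantCoeff_of_mem_hilbertIdeal hx]

lemma eval_harmonicHilbert_pos : 0 < (harmonicHilbert G).eval 1 := by
  have h0 : 0 < Module.finrank ℂ (harmonicDeg G 0) := by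
    have : Nontrivial (harmonicDeg G 0) :=
      ⟨⟨⟨1, one_mem_harmonicDeg⟩, 0, fun h => one_ne_zero (congrArg Subtype.val h)⟩⟩
    exact Module.finrank_pos
  rw [harmonicHilbert, Polynomial.eval_finsetSum]
  refine Finset.sum_pos' (fun k _ => by simp) ⟨0, by simp, ?_⟩
  simpa using h0

/-- The character of a representation at an involution, as a real number. -/
def involutionCharacter (r : G) : ℝ :=
  Module.finrank ℂ V - 2 * Module.finrank ℂ (Module.End.eigenspace (ρ r) (-1))

/-- For an involution `(1 - ρ r) / 2` projects onto the eigenspace of -1, so its trace is the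
dimension of that space. -/
lemma character_eq_involutionCharacter {r : G} (hr : r * r = 1) :
    ρ.character r = (involutionCharacter ρ r : ℂ) := by
  have hsq : ∀ x, ρ r (ρ r x) = x := fun x => by
    rw [← Module.End.mul_apply, ← map_mul, hr, map_one, Module.End.one_apply]
  have hproj : LinearMap.IsProj (Module.End.eigenspace (ρ r) (-1))
      ((2 : ℂ)⁻¹ • (LinearMap.id - ρ r)) := by
    constructor
    · intro x
      rw [Module.End.mem_eigenspace_iff]
      simp only [LinearMap.smul_apply, LinearMap.sub_apply, LinearMap.id_apply, map_smul, map_sub,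
        hsq]
      module
    · intro x hx
      rw [Module.End.mem_eigenspace_iff] at hx
      simp only [LinearMap.smul_apply, LinearMap.sub_apply, LinearMap.id_apply, hx]
      module
  have htr := hproj.trace
  rw [map_smul, map_sub, LinearMap.trace_id, smul_eq_mul] at htr
  rw [involutionCharacter, Representation.character]
  push_cast
  linear_combination (-2 : ℂ) * htr

lemma eval_poincare [Fintype G] (hG : IsReflectionGroup G) : (poincare G ρ).eval 1 =
    (Nat.card G : ℝ)⁻¹ * (Module.finrank ℂ V * (harmonicHilbert G).eval 1) := by
  apply Complex.ofReal_injective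
  have h1 := congrArg (Polynomial.eval 1) (map_poincare ρ)
  rw [← map_one Complex.ofRealHom, Polynomial.eval_map_apply, map_one, Polynomial.eval_mul,
    Polynomial.eval_C, Polynomial.eval_finsetSum, Finset.sum_eq_single 1] at h1
  · refine h1.trans ?_
    rw [Polynomial.eval_mul, gradedCharacter_one, ← map_one Complex.ofRealHom,
      Polynomial.eval_map_apply]
    simp
  · intro g _ hg
    rw [Polynomial.eval_mul, eval_gradedCharacter_of_ne_one hG hg, mul_zero]
  · simp

/-- In the average over the group only the identity and the reflections contribute to first order at
1. -/
lemma eval_derivative_poincare [Fintype G] (hG : IsReflectionGroup G) :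
    (poincare G ρ).derivative.eval 1 = (Nat.card G : ℝ)⁻¹ *
      (Module.finrank ℂ V * (harmonicHilbert G).derivative.eval 1 -
        (harmonicHilbert G).eval 1 / 2 *
          ∑ r ∈ reflections G, involutionCharacter ρ r) := by
  apply Complex.ofReal_injective
  have h1 := congrArg (fun p => (Polynomial.derivative p).eval 1) (map_poincare ρ)
  classical
  have hone : (1 : G) ∉ reflections G :=
    fun h => (mem_reflections.1 h).ne_one rfl
  have hH : (gradedCharacter (1 : G)).eval 1 = ((harmonicHilbert G).eval 1 : ℝ) := by
    rw [gradedCharacter_one, ← map_one Complex.ofRealHom, Polynomial.eval_map_apply]; simp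
  have hH' : (gradedCharacter (1 : G)).derivative.eval 1 =
      ((harmonicHilbert G).derivative.eval 1 : ℝ) := by
    rw [gradedCharacter_one, Polynomial.derivative_map, ← map_one Complex.ofRealHom,
      Polynomial.eval_map_apply]; simp
  rw [Polynomial.derivative_map, ← map_one Complex.ofRealHom, Polynomial.eval_map_apply, map_one,
    Polynomial.derivative_C_mul, Polynomial.derivative_sum, Polynomial.eval_mul, Polynomial.eval_C,
    Polynomial.eval_finsetSum] at h1
  refine h1.trans ?_
  simp only [Polynomial.derivative_C_mul, Polynomial.eval_mul, Polynomial.eval_C]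
  rw [← Finset.sum_subset (Finset.subset_univ
    (insert 1 (reflections G))),
    Finset.sum_insert hone]
  · rw [hH', Finset.sum_congr rfl (g := fun r => (involutionCharacter ρ r : ℂ) *
      (-(((harmonicHilbert G).eval 1 : ℝ) / 2)))]
    · rw [← Finset.sum_mul]
      push_cast
      simp
      ring
    · intro r hr
      have hr := mem_reflections.1 hr
      have hrr : r * r = 1 := Subtype.ext hr.mul_self
      rw [eval_derivative_gradedCharacter_of_isReflection hG hr, hH,
        ← eq_inv_of_mul_eq_one_left hrr, character_eq_involutionCharacter ρ hrr]
  · intro g _ hg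
    rw [Finset.mem_insert, not_or] at hg
    rw [eval_derivative_gradedCharacter_of_not_isReflection hG hg.1 fun h => hg.2 (mem_reflections.2 h),
      mul_zero]

/-- The logarithmic derivative at `1` of the Poincaré polynomial. -/
lemma logDeriv_poincare [Fintype G] [Nontrivial V] (hG : IsReflectionGroup G) :
    (poincare G ρ).derivative.eval 1 / (poincare G ρ).eval 1 =
      (harmonicHilbert G).derivative.eval 1 / (harmonicHilbert G).eval 1 -
        (∑ r ∈ reflections G, involutionCharacter ρ r) /
          (2 * Module.finrank ℂ V) := by
  have h1 := (eval_harmonicHilbert_pos (G := G)).ne'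
  have h2 : (Nat.card G : ℝ) ≠ 0 := Nat.cast_ne_zero.2 Nat.card_pos.ne'
  have h3 : (Module.finrank ℂ V : ℝ) ≠ 0 := Nat.cast_ne_zero.2 Module.finrank_pos.ne'
  rw [eval_poincare ρ hG, eval_derivative_poincare ρ hG]
  field_simp

lemma eval_poincare_pos [Finite G] [Nontrivial V] (hG : IsReflectionGroup G) :
    0 < (poincare G ρ).eval 1 := by
  cases nonempty_fintype G
  have h1 := eval_harmonicHilbert_pos (G := G)
  have h2 : (0 : ℝ) < Nat.card G := Nat.cast_pos.2 Nat.card_pos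
  have h3 : (0 : ℝ) < Module.finrank ℂ V := Nat.cast_pos.2 Module.finrank_pos
  rw [eval_poincare ρ hG]
  positivity

end Multiplicity

/-- An invariant harmonic polynomial of positive degree lies in the ideal to which it is orthogonal,
so it is zero. -/
lemma multiplicity_charRep_one {k : ℕ} (hk : k ≠ 0) :
    multiplicity G (charRep (1 : G →* ℂˣ)) k = 0 := by
  have : Subsingleton (homToHarmonic G (charRep (1 : G →* ℂˣ)) k) := by
    refine subsingleton_of_forall_eq 0 fun f => Subtype.ext ?_
    refine Representation.IntertwiningMap.ext (LinearMap.ext_ring ?_)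
    change f.1 1 = 0
    refine disjoint_hilbertIdeal_harmonic (f.2 1).1
      (mem_hilbertIdeal_of_isInvariant (fun g => ?_) ?_)
    · rw [← f.1.isIntertwining]
      simp [charRep]
    · rw [constantCoeff_eq]
      refine IsHomogeneous.coeff_eq_zero (f.2 1).2 ?_
      simpa using hk.symm
  exact Module.finrank_zero_of_subsingleton

/-- The Poincaré polynomial of the trivial representation is constant, so the left side of its
`logDeriv_poincare` is zero. The degrees of basic invariants are not needed. -/
lemma logDeriv_harmonicHilbert [Fintype G] (hG : IsReflectionGroup G) :
    (harmonicHilbert G).derivative.eval 1 / (harmonicHilbert G).eval 1 =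
      (reflections G).card / 2 := by
  have h1 := logDeriv_poincare (charRep (1 : G →* ℂˣ)) hG
  have h2 : (poincare G (charRep (1 : G →* ℂˣ))).derivative = 0 := by
    ext k
    rw [Polynomial.coeff_derivative, coeff_poincare, multiplicity_charRep_one k.succ_ne_zero]
    simp
  have h3 : ∀ r ∈ reflections G,
      involutionCharacter (charRep (1 : G →* ℂˣ)) r = 1 := fun r hr => by
    have hr := mem_reflections.1 hr
    have h4 := character_eq_involutionCharacter (charRep (1 : G →* ℂˣ))
      (r := r) (Subtype.ext hr.mul_self)
    apply Complex.ofReal_injective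
    rw [← h4, Representation.character]
    simp [charRep]
  rw [h2, Polynomial.eval_zero, zero_div, Finset.sum_congr rfl h3] at h1
  simp at h1
  linarith

/-! ### The formula for `d⁻` -/

section DMinus

variable {V : Type*} [AddCommGroup V] [Module ℂ V] [FiniteDimensional ℂ V]
  (ρ : Representation ℂ G V)

lemma involutionCharacter_of_isConj {s r : G} (hs : s * s = 1) (hr : r * r = 1)
    (h : IsConj s r) : involutionCharacter ρ r = involutionCharacter ρ s := by
  obtain ⟨g, rfl⟩ := isConj_iff.1 h
  apply Complex.ofReal_injective
  rw [← character_eq_involutionCharacter ρ hs, ← character_eq_involutionCharacter ρ hr,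
    Representation.char_conj]

open Classical in
lemma involutionCharacter_tprod_charRep {s : G} {χ : G →* ℂˣ} (hχ : IsClassCharacter s χ) {r : G}
    (hr : IsReflection (r : OrthGroup n)) :
    involutionCharacter (ρ.tprod (charRep χ)) r =
      if IsConj s r then -involutionCharacter ρ r else involutionCharacter ρ r := by
  have hrr : r * r = 1 := Subtype.ext hr.mul_self
  apply Complex.ofReal_injective
  rw [← character_eq_involutionCharacter _ hrr, Representation.char_tensor, Pi.mul_apply,
    character_eq_involutionCharacter ρ hrr]
  have : (charRep χ).character r = (χ r : ℂ) := by
    simp [Representation.character, charRep]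
  rw [this, hχ r hr]
  split_ifs <;> simp

lemma dMinus_eq [Nontrivial V] (s : G) : dMinus s ρ =
    classCard s - classCard s * involutionCharacter ρ s / Module.finrank ℂ V := by
  have h3 : (Module.finrank ℂ V : ℝ) ≠ 0 := Nat.cast_ne_zero.2 Module.finrank_pos.ne'
  rw [dMinus, involutionCharacter]
  field_simp
  ring

open Classical in
lemma classCard_eq [Fintype G] {s : G} (hs : IsReflection (s : OrthGroup n)) :
    classCard s = ((reflections G).filter (IsConj s)).card := by
  rw [classCard, Nat.card_eq_fintype_card, Fintype.card_subtype]
  congr 1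
  ext r
  simp only [Finset.mem_filter, Finset.mem_univ, true_and, mem_reflections]
  exact ⟨fun h => ⟨hs.of_isConj h, h⟩, fun h => h.2⟩

lemma hasDerivAt_log_eval {P : Polynomial ℝ} (hP : 0 < P.eval 1) :
    HasDerivAt (fun t : ℝ => Real.log (P.eval t)) (P.derivative.eval 1 / P.eval 1) 1 :=
  (P.hasDerivAt 1).log hP.ne'

lemma deriv_log_eval_div {P Q : Polynomial ℝ} (hP : 0 < P.eval 1) (hQ : 0 < Q.eval 1) :
    deriv (fun t : ℝ => Real.log (P.eval t / Q.eval t)) 1 =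
      P.derivative.eval 1 / P.eval 1 - Q.derivative.eval 1 / Q.eval 1 := by
  have h := ((P.hasDerivAt 1).div (Q.hasDerivAt 1) hQ.ne').log (div_pos hP hQ).ne'
  refine h.deriv.trans ?_
  have := hP.ne'
  have := hQ.ne'
  simp only [Pi.div_apply]
  field_simp

/-- The contribution of the Hilbert polynomial of the harmonics cancels between the two
representations, and the sums over reflections differ only on the class of `s`, where twisting
reverses the sign. -/
lemma dMinus_eq_classCard_add [Nontrivial V] (hG : IsReflectionGroup G) {s : G}
    (hs : IsReflection (s : OrthGroup n)) {χ : G →* ℂˣ} (hχ : IsClassCharacter s χ) :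
    dMinus s ρ = classCard s + deriv (fun t : ℝ => Real.log ((poincare G ρ).eval t /
      (poincare G (ρ.tprod (charRep χ))).eval t)) 1 := by
  classical
  have := hG.finite
  cases nonempty_fintype G
  have hss : s * s = 1 := Subtype.ext hs.mul_self
  have hfin : Module.finrank ℂ (TensorProduct ℂ V ℂ) = Module.finrank ℂ V := by simp
  have hfin0 : Module.finrank ℂ V ≠ 0 := Module.finrank_pos.ne'
  have : Nontrivial (TensorProduct ℂ V ℂ) :=
    Module.nontrivial_of_finrank_pos (R := ℂ) (by omega)
  have hsum : ∑ r ∈ reflections G, involutionCharacter ρ r -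
      ∑ r ∈ reflections G, involutionCharacter (ρ.tprod (charRep χ)) r =
      2 * (classCard s * involutionCharacter ρ s) := by
    rw [← Finset.sum_sub_distrib, classCard_eq hs, ← nsmul_eq_mul, ← Finset.sum_const,
      Finset.sum_filter, Finset.mul_sum]
    refine Finset.sum_congr rfl fun r hr => ?_
    rw [mem_reflections] at hr
    rw [involutionCharacter_tprod_charRep ρ hχ hr]
    split_ifs with hc
    · rw [involutionCharacter_of_isConj ρ hss (Subtype.ext hr.mul_self) hc]; ring
    · ring
  rw [deriv_log_eval_div (eval_poincare_pos ρ hG) (eval_poincare_pos _ hG), logDeriv_poincare _ hG,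
    logDeriv_poincare _ hG, hfin, dMinus_eq]
  have h3 : (Module.finrank ℂ V : ℝ) ≠ 0 := Nat.cast_ne_zero.2 hfin0
  field_simp
  linear_combination hsum

/-- With a single class the character is constant on all reflections and `logDeriv_harmonicHilbert`
supplies the remaining term, so no twisted representation is needed for comparison. -/
lemma dMinus_eq_two_mul_deriv_log [Nontrivial V] (hG : IsReflectionGroup G) {s : G}
    (hs : IsReflection (s : OrthGroup n))
    (hall : ∀ r : G, IsReflection (r : OrthGroup n) → IsConj s r) :
    dMinus s ρ = 2 * deriv (fun t : ℝ => Real.log ((poincare G ρ).eval t)) 1 := by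
  classical
  have := hG.finite
  cases nonempty_fintype G
  have hss : s * s = 1 := Subtype.ext hs.mul_self
  have hcard : classCard s = (reflections G).card := by
    rw [classCard_eq hs, Finset.filter_true_of_mem fun r hr => hall r (mem_reflections.1 hr)]
  rw [(hasDerivAt_log_eval (eval_poincare_pos ρ hG)).deriv, logDeriv_poincare ρ hG,
    logDeriv_harmonicHilbert hG, dMinus_eq, hcard,
    Finset.sum_congr rfl fun r hr => involutionCharacter_of_isConj ρ hss
      (Subtype.ext (mem_reflections.1 hr).mul_self) (hall r (mem_reflections.1 hr)),
    Finset.sum_const, nsmul_eq_mul]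
  have h3 : (Module.finrank ℂ V : ℝ) ≠ 0 := Nat.cast_ne_zero.2 Module.finrank_pos.ne'
  field_simp

end DMinus

lemma nontrivial_of_isIrreducible {V : Type*} [AddCommGroup V] [Module ℂ V]
    {ρ : Representation ℂ G V} (h : ρ.IsIrreducible) : Nontrivial V := by
  by_contra hV
  rw [not_nontrivial_iff_subsingleton] at hV
  have := h
  have : (⊥ : Subrepresentation ρ) ≠ ⊤ := bot_ne_top
  apply this
  ext x
  rw [Subsingleton.elim x 0]
  exact ⟨fun _ => zero_mem _, fun _ => zero_mem _⟩

end CoxeterHarmonic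

end

theorem proposition4p2 (n : ℕ) (G : Subgroup (CoxeterHarmonic.OrthGroup n))
    (hG : CoxeterHarmonic.IsReflectionGroup G)
    (s : G) (hs : CoxeterHarmonic.IsReflection (s : CoxeterHarmonic.OrthGroup n)) :
    -- the character attached to the conjugacy class of `s` exists and is unique
    (∃! χ : G →* ℂˣ, CoxeterHarmonic.IsClassCharacter s χ) ∧
    ∀ (χ : G →* ℂˣ), CoxeterHarmonic.IsClassCharacter s χ →
    ∀ (V : Type*) [AddCommGroup V] [Module ℂ V] [FiniteDimensional ℂ V]
      (ρ : Representation ℂ G V), ρ.IsIrreducible →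
      -- both Poincaré polynomials are genuine polynomials, positive at `1`
      (∀ k, (CoxeterHarmonic.poincare G ρ).coeff k = CoxeterHarmonic.multiplicity G ρ k) ∧
      (∀ k, (CoxeterHarmonic.poincare G (ρ.tprod (CoxeterHarmonic.charRep χ))).coeff k =
        CoxeterHarmonic.multiplicity G (ρ.tprod (CoxeterHarmonic.charRep χ)) k) ∧
      0 < (CoxeterHarmonic.poincare G ρ).eval 1 ∧
      0 < (CoxeterHarmonic.poincare G (ρ.tprod (CoxeterHarmonic.charRep χ))).eval 1 ∧
      -- the formula for `d⁻` of the conjugacy class of `s`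
      CoxeterHarmonic.dMinus s ρ = CoxeterHarmonic.classCard s +
        deriv (fun t : ℝ => Real.log ((CoxeterHarmonic.poincare G ρ).eval t /
          (CoxeterHarmonic.poincare G (ρ.tprod (CoxeterHarmonic.charRep χ))).eval t)) 1 ∧
      -- the case of a single conjugacy class of reflections
      ((∀ r : G, CoxeterHarmonic.IsReflection (r : CoxeterHarmonic.OrthGroup n) → IsConj s r) →
        CoxeterHarmonic.dMinus s ρ =
          2 * deriv (fun t : ℝ => Real.log ((CoxeterHarmonic.poincare G ρ).eval t)) 1) := by
  have := hG.finite
  refine ⟨?_, fun χ hχ V _ _ _ ρ hρ => ?_⟩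
  · obtain ⟨χ, hχ⟩ := CoxeterHarmonic.exists_isClassCharacter s hs
    exact ⟨χ, hχ, fun χ' hχ' => CoxeterHarmonic.isClassCharacter_unique hG hχ' hχ⟩
  · have := CoxeterHarmonic.nontrivial_of_isIrreducible hρ
    have : Nontrivial (TensorProduct ℂ V ℂ) := (TensorProduct.rid ℂ V).toEquiv.nontrivial
    exact ⟨CoxeterHarmonic.coeff_poincare ρ, CoxeterHarmonic.coeff_poincare _,
      CoxeterHarmonic.eval_poincare_pos ρ hG, CoxeterHarmonic.eval_poincare_pos _ hG,
      CoxeterHarmonic.dMinus_eq_classCard_add ρ hG hs hχ,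
      CoxeterHarmonic.dMinus_eq_two_mul_deriv_log ρ hG hs⟩
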